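/- Let $\mathbb F$ be a field and let $(C,d,\mathcal F)$ be a filtered chain complex over $\mathbb F$: a chain complex $C=\bigoplus_{n\in\mathbb Z}C_n$ of $\mathbb F$-spaces with $d(C_n)\subset C_{n-1}$, and an ascending $\mathbb Z$-filtration $\mathcal F^pC_n$ of each $C_n$ with $d(\mathcal F^pC_n)\subset\mathcal F^pC_{n-1}$. Assume that for each $n$ there is a $p$ with $\mathcal F^pC_n=0$, and that $\dim_{\mathbb F}\mathcal F^pC_n<\infty$ for all $p,n$. Let $PC=\bigoplus_p\mathcal F^pC$ be the persistent chain complex, a complex of graded $\mathbb F[x]$-modules on which $x$ (of degree $1$) acts by the inclusions $\mathcal F^pC\hookrightarrow\mathcal F^{p+1}C$. Let $E^{(r)}$, $r\ge1$, be the $r$-th page of the spectral sequence of $(C,d,\mathcal F)$, that is, the $E$-term of the exact couple $H(PC)\xrightarrow{x}H(PC)\to H(PC/xPC)\to H(PC)$ derived $r-1$ times, and let $E^{(r)}_n=\bigoplus_sE^{(r)}_{n,s}$ be its part of homological degree $n$. For each $n$, there are $K_n\in\{0,1,2,\dots,\infty\}$ and a sequence $\{(s_n(i),m_n(i))\}_{i=1}^{K_n}$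 in $\mathbb Z\times\{1,2,\dots,\infty\}$, ordered lexicographically and with $\{i : s_n(i)=s\}$ finite for every $s$, such that $H_n(PC)\cong\bigoplus_i\big(\mathbb F[x]/(x^{m_n(i)})\big)\{s_n(i)\}$ as graded $\mathbb F[x]$-modules, where $x^\infty=0$ and $\{s\}$ means that the generator $1$ has degree $s$. For any such sequences, put $\nu_{n,s,m}=\#\{i : s_n(i)=s,\ m_n(i)=m\}$. For $i\le j$ let $b_n^{i,j}$ (the persistent Betti number) be the rank of $H_n(\mathcal F^iC)\to H_n(\mathcal F^jC)$; for $i<j$ let $\mu_n^{i,j}=(b_n^{i,j-1}-b_n^{i,j})-(b_n^{i-1,j-1}-b_n^{i-1,j})$ (the persistent multiplicity); and let $b_n(\mathcal F)=\sup_i\inf_{j\ge i}b_n^{i,j}$, which equals $\dim_{\mathbb F}H_n\big(\bigcup_p\mathcal F^pC\big)$. All dimensions, cardinalities and sums of non-negative terms below are taken in $\{0,1,2,\dots,\infty\}$. Then for every integer $r>0$ and every $n\in\mathbb Z$, $$\dim_{\mathbb F}E_n^{(r)}=\sum_{s\in\mathbb Z}\Big(\nu_{n,s,\infty}+\sum_{r\le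 m<\infty}(\nu_{n,s,m}+\nu_{n-1,s,m})\Big)\qquad(1)$$ and $$\dim_{\mathbb F}E_n^{(r)}=b_n(\mathcal F)+\sum_{t-s\ge r}\big(\mu_n^{s,t}+\mu_{n-1}^{s,t}\big).\qquad(2)$$ The two formulas are translated into each other by $\nu_{n,s,t-s}=\mu_n^{s,t}\ge0$ for $s<t$, and $\sum_s\nu_{n,s,\infty}=b_n(\mathcal F)$. -/

import Mathlib

universe u v w

namespace PersistentSS

open CategoryTheory CategoryTheory.Limits

/-! ### Graded modules over the polynomial ring -/

/-- A `ℤ`-graded module over `F[x]` with `deg x = 1`, given by its homogeneous components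
`comp p` and by the action `x : comp p → comp (p + 1)` of the indeterminate. -/
structure GradedPolyModule (F : Type u) [Field F] where
  comp : ℤ → Type w
  [addCommGroup : ∀ p, AddCommGroup (comp p)]
  [module : ∀ p, Module F (comp p)]
  x : ∀ p, comp p →ₗ[F] comp (p + 1)

attribute [instance] GradedPolyModule.addCommGroup GradedPolyModule.module

namespace GradedPolyModule

variable {F : Type u} [Field F]

/-- Isomorphisms of graded `F[x]`-modules (of degree `0`). -/
structure Iso (M : GradedPolyModule.{u, v} F) (N : GradedPolyModule.{u, w} F) where
  equiv : ∀ p, M.comp p ≃ₗ[F] N.comp p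
  comm : ∀ p (a : M.comp p), equiv (p + 1) (M.x p a) = N.x p (equiv p a)

/-- The direct sum of a family of graded `F[x]`-modules. -/
noncomputable def directSum {ι : Type} (M : ι → GradedPolyModule.{u, w} F) :
    GradedPolyModule.{u, w} F where
  comp p := DirectSum ι fun i => (M i).comp p
  x p := DirectSum.lmap fun i => (M i).x p

end GradedPolyModule

/-- The ideal `(x ^ m)` of `F[x]`, where `(x ^ ∞) = 0`. -/
noncomputable def powIdeal (F : Type u) [Field F] (m : ℕ∞) : Ideal (Polynomial F) :=
  Ideal.span {a | ∃ j : ℕ, (j : ℕ∞) = m ∧ a = Polynomial.X ^ j}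

/-- The homogeneous component of degree `p` of `F[x] / (x ^ m) {s}`, where `{s}` is the shift by
which the generator `1` has degree `s`: it is spanned by `x ^ j` if `p = s + j` with `j ≥ 0`,
and it is zero if `p < s`. -/
noncomputable def cyclicComp (F : Type u) [Field F] (s : ℤ) (m : ℕ∞) (p : ℤ) :
    Submodule F (Polynomial F ⧸ powIdeal F m) :=
  Submodule.span F {a | ∃ j : ℕ, p = s + j ∧ a = Ideal.Quotient.mk _ (Polynomial.X ^ j)}

theorem mul_mem_cyclicComp (F : Type u) [Field F] (s : ℤ) (m : ℕ∞) (p : ℤ) :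
    ∀ a ∈ cyclicComp F s m p,
      LinearMap.mulLeft F (Ideal.Quotient.mk (powIdeal F m) Polynomial.X) a
        ∈ cyclicComp F s m (p + 1) := by
  intro a ha
  have : cyclicComp F s m p ≤ (cyclicComp F s m (p + 1)).comap
      (LinearMap.mulLeft F (Ideal.Quotient.mk (powIdeal F m) Polynomial.X)) := by
    refine Submodule.span_le.2 ?_
    rintro _ ⟨j, hj, rfl⟩
    refine Submodule.subset_span ⟨j + 1, by push_cast; omega, ?_⟩
    rw [LinearMap.mulLeft_apply, ← map_mul, pow_succ']
  exact this ha

/-- The graded `F[x]`-module `F[x] / (x ^ m) {s}` for `m < ∞`, and `F[x] {s}` for `m = ∞`. -/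
noncomputable def cyclic (F : Type u) [Field F] (s : ℤ) (m : ℕ∞) : GradedPolyModule.{u, u} F where
  comp p := cyclicComp F s m p
  x p := (LinearMap.mulLeft F (Ideal.Quotient.mk (powIdeal F m) Polynomial.X)).restrict
    (mul_mem_cyclicComp F s m p)

/-! ### Exact couples -/

/-- A bigraded exact couple of `F`-spaces: the first degree is the homological one, the map `f`
has bidegree `(0, 1)`, the map `g` has bidegree `(0, -k)` and the map `h` has bidegree
`(-1, -1)`. -/
structure ExactCouple (F : Type u) [Field F] (k : ℕ) where
  A : ℤ → ℤ → Type v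
  E : ℤ → ℤ → Type v
  [addCommGroupA : ∀ n p, AddCommGroup (A n p)]
  [moduleA : ∀ n p, Module F (A n p)]
  [addCommGroupE : ∀ n p, AddCommGroup (E n p)]
  [moduleE : ∀ n p, Module F (E n p)]
  f : ∀ n p q : ℤ, p + 1 = q → (A n p →ₗ[F] A n q)
  g : ∀ n p q : ℤ, q + k = p → (A n p →ₗ[F] E n q)
  h : ∀ n n' p q : ℤ, n' + 1 = n → q + 1 = p → (E n p →ₗ[F] A n' q)
  exact_fg : ∀ (n p q s : ℤ) (hp : p + 1 = q) (hs : s + k = q), Function.Exact (f n p q hp) (g n q s hs)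
  exact_gh : ∀ (n n' p q s : ℤ) (hn : n' + 1 = n) (hq : q + k = p) (hs : s + 1 = q),
    Function.Exact (g n p q hq) (h n n' q s hn hs)
  exact_hf : ∀ (n n' p q s : ℤ) (hn : n' + 1 = n) (hq : q + 1 = p) (hs : q + 1 = s),
    Function.Exact (h n n' p q hn hq) (f n' q s hs)

attribute [instance] ExactCouple.addCommGroupA ExactCouple.moduleA ExactCouple.addCommGroupE
  ExactCouple.moduleE

namespace ExactCouple

variable {F : Type u} [Field F] {k : ℕ} (X : ExactCouple.{u, v} F k)

/-- The differential `d = g ∘ h` on `E`. -/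
def d (n n' p q : ℤ) (hn : n' + 1 = n) (hq : q + k + 1 = p) : X.E n p →ₗ[F] X.E n' q :=
  X.g n' (p - 1) q (by omega) ∘ₗ X.h n n' p (p - 1) hn (by omega)

/-- `ker d` in bidegree `(n, p)`. -/
def cycles (n p : ℤ) : Submodule F (X.E n p) :=
  LinearMap.ker (X.d n (n - 1) p (p - k - 1) (by omega) (by omega))

/-- `im d` in bidegree `(n, p)`. -/
def boundaries (n p : ℤ) : Submodule F (X.E n p) :=
  LinearMap.range (X.d (n + 1) n (p + k + 1) p rfl rfl)

/-- `A' = f(A)`. -/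
abbrev derivedA (n p : ℤ) : Submodule F (X.A n p) :=
  LinearMap.range (X.f n (p - 1) p (by omega))

/-- `E' = ker d / im d`. -/
abbrev derivedE (n p : ℤ) : Type v :=
  X.cycles n p ⧸ (X.boundaries n p).submoduleOf (X.cycles n p)

theorem f_mem_derivedA (n p q : ℤ) (hp : p + 1 = q) (a : X.A n p) :
    X.f n p q hp a ∈ X.derivedA n q := by
  obtain rfl : p = q - 1 := by omega
  exact ⟨a, rfl⟩

theorem g_mem_cycles (n p q : ℤ) (hq : q + k = p) (a : X.A n p) :
    X.g n p q hq a ∈ X.cycles n q := by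
  simp only [cycles, d, LinearMap.mem_ker, LinearMap.comp_apply]
  rw [(X.exact_gh n (n - 1) p q (q - 1) (by omega) hq (by omega)).apply_apply_eq_zero, map_zero]

theorem g_mem_boundaries (n p q : ℤ) (hq : q + k = p) (p' : ℤ) (hp : p + 1 = p') (a : X.A n p)
    (ha : X.f n p p' hp a = 0) : X.g n p q hq a ∈ X.boundaries n q := by
  obtain rfl : p = q + k + 1 - 1 := by omega
  obtain ⟨e, rfl⟩ := (X.exact_hf (n + 1) n (q + k + 1) (q + k + 1 - 1) p' rfl (by omega) hp a).1 ha
  exact ⟨e, rfl⟩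

theorem h_mem_derivedA (n n' p q : ℤ) (hn : n' + 1 = n) (hq : q + 1 = p) (e : X.E n p)
    (he : e ∈ X.cycles n p) : X.h n n' p q hn hq e ∈ X.derivedA n' q := by
  obtain rfl : n' = n - 1 := by omega
  obtain rfl : q = p - 1 := by omega
  exact (X.exact_fg (n - 1) (p - 1 - 1) (p - 1) (p - k - 1) (by omega) (by omega) _).1 he

theorem mem_cycles_of_h (n n' p q : ℤ) (hn : n' + 1 = n) (hq : q + 1 = p) (e : X.E n p)
    (he : X.h n n' p q hn hq e ∈ X.derivedA n' q) : e ∈ X.cycles n p := by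
  obtain rfl : n' = n - 1 := by omega
  obtain rfl : q = p - 1 := by omega
  exact (X.exact_fg (n - 1) (p - 1 - 1) (p - 1) (p - k - 1) (by omega) (by omega) _).2 he

theorem h_eq_zero (n n' p q : ℤ) (hn : n' + 1 = n) (hq : q + 1 = p) (e : X.E n p)
    (he : e ∈ X.boundaries n p) : X.h n n' p q hn hq e = 0 := by
  obtain ⟨b, rfl⟩ := he
  exact (X.exact_gh n n' (p + k + 1 - 1) p q hn (by omega) hq).apply_apply_eq_zero _

/-- `f' = f|_{A'}`. -/
def derivedF (n p q : ℤ) (hp : p + 1 = q) : X.derivedA n p →ₗ[F] X.derivedA n q :=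
  (X.f n p q hp ∘ₗ (X.derivedA n p).subtype).codRestrict _
    fun a => X.f_mem_derivedA n p q hp a

/-- `g' (f a) = g a + im d`. -/
noncomputable def derivedG (n p q : ℤ) (hq : q + (k + 1 : ℕ) = p) :
    X.derivedA n p →ₗ[F] X.derivedE n q :=
  Submodule.liftQ (LinearMap.ker (X.f n (p - 1) p (by omega)))
    (Submodule.mkQ _ ∘ₗ (X.g n (p - 1) q (by push_cast at hq; omega)).codRestrict (X.cycles n q)
      fun a => X.g_mem_cycles n (p - 1) q _ a)
    (fun a ha => by
      rw [LinearMap.mem_ker, LinearMap.comp_apply, Submodule.mkQ_apply,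
        Submodule.Quotient.mk_eq_zero]
      exact X.g_mem_boundaries n (p - 1) q _ p _ a ha)
  ∘ₗ (X.f n (p - 1) p (by omega)).quotKerEquivRange.symm.toLinearMap

/-- `h' (b + im d) = h b`. -/
def derivedH (n n' p q : ℤ) (hn : n' + 1 = n) (hq : q + 1 = p) :
    X.derivedE n p →ₗ[F] X.derivedA n' q :=
  Submodule.liftQ _
    ((X.h n n' p q hn hq ∘ₗ (X.cycles n p).subtype).codRestrict _
      fun e => X.h_mem_derivedA n n' p q hn hq e e.2)
    (fun e he => by
      rw [LinearMap.mem_ker]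
      exact Subtype.ext (X.h_eq_zero n n' p q hn hq e he))

theorem derivedG_apply (n p q : ℤ) (hq : q + (k + 1 : ℕ) = p) (a : X.A n (p - 1)) :
    X.derivedG n p q hq ⟨X.f n (p - 1) p (by omega) a, a, rfl⟩ =
      Submodule.Quotient.mk ⟨X.g n (p - 1) q (by push_cast at hq; omega) a,
        X.g_mem_cycles n (p - 1) q _ a⟩ := by
  have : (⟨X.f n (p - 1) p (by omega) a, a, rfl⟩ : X.derivedA n p) =
      (X.f n (p - 1) p (by omega)).quotKerEquivRange (Submodule.Quotient.mk a) := rfl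
  rw [this]
  simp only [derivedG, LinearMap.comp_apply, LinearEquiv.coe_coe, LinearEquiv.symm_apply_apply]
  rfl

/-- The derived exact couple. -/
noncomputable def derive : ExactCouple.{u, v} F (k + 1) where
  A n p := X.derivedA n p
  E n p := X.derivedE n p
  f := X.derivedF
  g := X.derivedG
  h := X.derivedH
  exact_fg n p q s hp hs := by
    obtain rfl : p = q - 1 := by omega
    rintro ⟨_, a, rfl⟩
    rw [derivedG_apply, Submodule.Quotient.mk_eq_zero]
    constructor
    · rintro ⟨e, he⟩
      have h1 : X.g n (q - 1) s (by push_cast at hs; omega) a ∈ X.boundaries n s := ⟨e, he⟩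
      obtain rfl : q = s + k + 1 := by push_cast at hs; omega
      have h2 : X.g n (s + k + 1 - 1) s (by omega)
          (a - X.h (n + 1) n (s + k + 1) (s + k + 1 - 1) rfl (by omega) e) = 0 := by
        rw [map_sub, sub_eq_zero]; exact he.symm
      obtain ⟨b, hb⟩ := (X.exact_fg n (s + k + 1 - 1 - 1) (s + k + 1 - 1) s (by omega)
        (by omega) _).1 h2
      refine ⟨⟨_, b, rfl⟩, Subtype.ext ?_⟩
      change X.f n _ _ _ (X.f n _ _ _ b) = X.f n _ _ _ a
      rw [hb, map_sub, (X.exact_hf (n + 1) n (s + k + 1) (s + k + 1 - 1) (s + k + 1) rfl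
        (by omega) (by omega)).apply_apply_eq_zero, sub_zero]
    · rintro ⟨⟨_, b, rfl⟩, hb⟩
      have hb' : X.f n (q - 1) q hp (X.f n (q - 1 - 1) (q - 1) (by omega) b) =
        X.f n (q - 1) q hp a := congrArg Subtype.val hb
      have h1 := X.g_mem_boundaries n (q - 1) s (by push_cast at hs; omega) q hp
        (a - X.f n (q - 1 - 1) (q - 1) (by omega) b) (by rw [map_sub, hb', sub_self])
      rw [map_sub, (X.exact_fg n (q - 1 - 1) (q - 1) s (by omega)
        (by push_cast at hs; omega)).apply_apply_eq_zero, sub_zero] at h1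
      exact h1
  exact_gh n n' p q s hn hq hs := by
    intro e
    obtain ⟨⟨e, he⟩, rfl⟩ := Submodule.Quotient.mk_surjective _ e
    constructor
    · intro h0
      have h1 : X.h n n' q s hn hs e = 0 := congrArg Subtype.val h0
      obtain ⟨a, rfl⟩ := (X.exact_gh n n' (p - 1) q s hn (by push_cast at hq; omega) hs e).1 h1
      exact ⟨⟨_, a, rfl⟩, X.derivedG_apply n p q hq a⟩
    · rintro ⟨⟨_, a, rfl⟩, ha⟩
      rw [derivedG_apply] at ha
      rw [← ha]
      exact Subtype.ext ((X.exact_gh n n' (p - 1) q s hn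
        (by push_cast at hq; omega) hs).apply_apply_eq_zero a)
  exact_hf n n' p q s hn hq hs := by
    rintro ⟨a, ha⟩
    constructor
    · intro h0
      have h1 : X.f n' q s hs a = 0 := congrArg Subtype.val h0
      obtain ⟨e, rfl⟩ := (X.exact_hf n n' p q s hn hq hs a).1 h1
      exact ⟨Submodule.Quotient.mk ⟨e, X.mem_cycles_of_h n n' p q hn hq e ha⟩, rfl⟩
    · rintro ⟨e, he⟩
      obtain ⟨e, rfl⟩ := Submodule.Quotient.mk_surjective _ e
      have h1 : X.h n n' p q hn hq e = a := congrArg Subtype.val he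
      subst h1
      exact Subtype.ext ((X.exact_hf n n' p q s hn hq hs).apply_apply_eq_zero _)

end ExactCouple

/-! ### Filtered chain complexes -/

/-- A filtered chain complex over `F`: a chain complex `C` of `F`-spaces with an ascending
`ℤ`-filtration `filt p n = 𝓕^p C_n` that is preserved by the differential. -/
structure FilteredComplex (F : Type u) [Field F] where
  C : ChainComplex (ModuleCat.{v} F) ℤ
  filt : ℤ → ∀ n : ℤ, Submodule F (C.X n)
  filt_mono : ∀ p q : ℤ, p ≤ q → ∀ n, filt p n ≤ filt q n
  d_mem : ∀ p n n' : ℤ, ∀ c ∈ filt p n, (C.d n n').hom c ∈ filt p n'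

/-- The subcomplex of a chain complex given by subspaces that the differential preserves. -/
def subcomplex {F : Type u} [Field F] (C : ChainComplex (ModuleCat.{v} F) ℤ)
    (V : ∀ n : ℤ, Submodule F (C.X n))
    (hV : ∀ n n' : ℤ, ∀ c ∈ V n, (C.d n n').hom c ∈ V n') : ChainComplex (ModuleCat.{v} F) ℤ where
  X n := ModuleCat.of F (V n)
  d n n' := ModuleCat.ofHom ((C.d n n').hom.restrict (hV n n'))
  shape n n' h := by
    ext c
    change (C.d n n').hom c.1 = 0
    rw [C.shape n n' h]; rfl
  d_comp_d' n n' n'' _ _ := by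
    ext c
    change (C.d n' n'').hom ((C.d n n').hom c.1) = 0
    rw [← ModuleCat.comp_apply, C.d_comp_d]; rfl

namespace FilteredComplex

variable {F : Type u} [Field F] (X : FilteredComplex.{u, v} F)

/-- `𝓕` is bounded below on each `C_n`, with a bound that may depend on `n`. -/
def BoundedBelow : Prop := ∀ n, ∃ p, X.filt p n = ⊥

/-- `dim 𝓕^p C_n < ∞` for all `p` and `n`. -/
def LocallyFinite : Prop := ∀ p n, FiniteDimensional F (X.filt p n)

/-- The complex `𝓕^p C`, which is the component of degree `p` of the persistent chain complex
`PC`. -/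
def level (p : ℤ) : ChainComplex (ModuleCat.{v} F) ℤ :=
  subcomplex X.C (X.filt p) (X.d_mem p)

/-- The inclusion `𝓕^p C → 𝓕^q C` for `p ≤ q`, which is the action of `x ^ (q - p)` on `PC`. -/
def incl (p q : ℤ) (hpq : p ≤ q) : X.level p ⟶ X.level q where
  f n := ModuleCat.ofHom (Submodule.inclusion (X.filt_mono p q hpq n))
  comm' _ _ _ := rfl

/-- The component of bidegree `(n, p)` of the persistent homology: `H_n(𝓕^p C)`. -/
noncomputable abbrev PHcomp (n p : ℤ) : ModuleCat.{v} F := (X.level p).homology n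

/-- The map `H_n(𝓕^p C) → H_n(𝓕^q C)` induced by the inclusion. -/
noncomputable def PHmap (n p q : ℤ) (hpq : p ≤ q) : X.PHcomp n p →ₗ[F] X.PHcomp n q :=
  (HomologicalComplex.homologyMap (X.incl p q hpq) n).hom

/-- The persistent homology `H_n(PC)` in homological degree `n`, a graded `F[x]`-module. -/
noncomputable def PH (n : ℤ) : GradedPolyModule.{u, v} F where
  comp p := X.PHcomp n p
  x p := X.PHmap n p (p + 1) (by omega)

/-- The sequence `0 → 𝓕^(p-1) C → 𝓕^p C → 𝓕^p C / 𝓕^(p-1) C → 0`, which is the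
component of degree `p` of `0 → PC{1} → PC → PC / x PC → 0`. -/
noncomputable def shortComplex (p : ℤ) : ShortComplex (ChainComplex (ModuleCat.{v} F) ℤ) :=
  ShortComplex.mk (X.incl (p - 1) p (by omega)) (cokernel.π (X.incl (p - 1) p (by omega)))
    (cokernel.condition _)

/-- The component of bidegree `(n, p)` of `H(PC / x PC)`. -/
noncomputable abbrev grHomology (n p : ℤ) : ModuleCat.{v} F :=
  (X.shortComplex p).X₃.homology n

theorem mono_incl (p q : ℤ) (hpq : p ≤ q) : Mono (X.incl p q hpq) := by
  have : ∀ n, Mono ((X.incl p q hpq).f n) := fun n =>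
    (ModuleCat.mono_iff_injective _).2
      (Submodule.inclusion_injective (X.filt_mono p q hpq n))
  exact HomologicalComplex.mono_of_mono_f _ inferInstance

theorem shortExact (p : ℤ) : (X.shortComplex p).ShortExact := by
  have : Mono (X.shortComplex p).f := X.mono_incl (p - 1) p (by omega)
  have : Epi (X.shortComplex p).g := by dsimp [shortComplex]; infer_instance
  exact ⟨ShortComplex.exact_cokernel _⟩

/-- The map `H_n(𝓕^p C) → H_n(𝓕^p C / 𝓕^(p-1) C)` induced by the quotient map. -/
noncomputable def toGr (n p : ℤ) : X.PHcomp n p →ₗ[F] X.grHomology n p :=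
  (HomologicalComplex.homologyMap (X.shortComplex p).g n).hom

/-- The connecting homomorphism `H_n(𝓕^p C / 𝓕^(p-1) C) → H_(n-1)(𝓕^(p-1) C)`. -/
noncomputable def connecting (n n' p : ℤ) (hn : n' + 1 = n) :
    X.grHomology n p →ₗ[F] X.PHcomp n' (p - 1) :=
  ((X.shortExact p).δ n n' hn).hom

theorem exact_PHmap_toGr (n p : ℤ) :
    Function.Exact (X.PHmap n (p - 1) p (by omega)) (X.toGr n p) :=
  (ShortComplex.ShortExact.moduleCat_exact_iff_function_exact _).1
    ((X.shortExact p).homology_exact₂ n)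

theorem exact_toGr_connecting (n n' p : ℤ) (hn : n' + 1 = n) :
    Function.Exact (X.toGr n p) (X.connecting n n' p hn) :=
  (ShortComplex.ShortExact.moduleCat_exact_iff_function_exact _).1
    ((X.shortExact p).homology_exact₃ n n' hn)

theorem exact_connecting_PHmap (n n' p : ℤ) (hn : n' + 1 = n) :
    Function.Exact (X.connecting n n' p hn) (X.PHmap n' (p - 1) p (by omega)) :=
  (ShortComplex.ShortExact.moduleCat_exact_iff_function_exact _).1
    ((X.shortExact p).homology_exact₁ n n' hn)

theorem PHmap_self (n p : ℤ) (hpp : p ≤ p) : X.PHmap n p p hpp = LinearMap.id := by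
  have : X.incl p p hpp = 𝟙 _ := by ext n c; rfl
  rw [PHmap, this, HomologicalComplex.homologyMap_id]
  rfl

/-- The exact couple with `A = H(PC)`, `E = H(PC / x PC)`, in which `f` is multiplication by `x`,
`g` is induced by the quotient map and `h` is the connecting homomorphism.  (In `g` the map
`PHmap n p q` has `p = q`, and in `h` the map `PHmap n' (p - 1) q` has `p - 1 = q`; both are
identity maps, which only identify equal degrees.) -/
noncomputable def firstCouple : ExactCouple.{u, v} F 0 where
  A n p := X.PHcomp n p
  E n p := X.grHomology n p
  f n p q hp := X.PHmap n p q (by omega)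
  g n p q hq := X.toGr n q ∘ₗ X.PHmap n p q (by push_cast at hq; omega)
  h n n' p q hn hq := X.PHmap n' (p - 1) q (by omega) ∘ₗ X.connecting n n' p hn
  exact_fg n p q s hp hs := by
    obtain rfl : s = q := by push_cast at hs; omega
    obtain rfl : p = s - 1 := by omega
    rw [PHmap_self, LinearMap.comp_id]
    exact X.exact_PHmap_toGr n s
  exact_gh n n' p q s hn hq hs := by
    obtain rfl : p = q := by push_cast at hq; omega
    obtain rfl : s = p - 1 := by omega
    rw [PHmap_self, PHmap_self, LinearMap.comp_id, LinearMap.id_comp]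
    exact X.exact_toGr_connecting n n' p hn
  exact_hf n n' p q s hn hq hs := by
    obtain rfl : s = p := by omega
    obtain rfl : q = s - 1 := by omega
    rw [PHmap_self, LinearMap.id_comp]
    exact X.exact_connecting_PHmap n n' s hn

/-- The first exact couple derived `k` times. -/
noncomputable def couple : ∀ k : ℕ, ExactCouple.{u, v} F k
  | 0 => X.firstCouple
  | k + 1 => (couple k).derive

/-- The component `E_{n,s}^(r)` of the page `E^(r)`, `r ≥ 1`, of the spectral sequence. -/
abbrev page (r : ℕ) (n s : ℤ) : Type v := (X.couple (r - 1)).E n s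

/-- `dim E_n^(r)`, where `E_n^(r)` is the direct sum of the components `E_{n,s}^(r)`. -/
noncomputable def pageDim (r : ℕ) (n : ℤ) : ℕ∞ :=
  Cardinal.toENat (Module.rank F (DirectSum ℤ fun s => X.page r n s))

/-- The persistent Betti number `b_n^{i,j}`, `i ≤ j`: the rank of `H_n(𝓕^i C) → H_n(𝓕^j C)`
(and `0` if `j < i`). -/
noncomputable def betti (n i j : ℤ) : ℕ :=
  if hij : i ≤ j then Module.finrank F (LinearMap.range (X.PHmap n i j hij)) else 0

/-- The persistent multiplicity `μ_n^{i,j}`, `i < j`. -/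
noncomputable def mu (n i j : ℤ) : ℤ :=
  ((X.betti n i (j - 1) : ℤ) - X.betti n i j) -
    ((X.betti n (i - 1) (j - 1) : ℤ) - X.betti n (i - 1) j)

/-- The persistent Betti number `b_n(𝓕)` of the whole filtration: the limit for `i → ∞` of the
limits for `j → ∞` of `b_n^{i,j}`, which increases with `i` and decreases with `j`. -/
noncomputable def totalBetti (n : ℤ) : ℕ∞ :=
  ⨆ i : ℤ, ⨅ j : {j : ℤ // i ≤ j}, (X.betti n i j : ℕ∞)

/-- The subcomplex `⋃_p 𝓕^p C` of `C`; it is `C` itself if the filtration is exhaustive. -/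
def union : ChainComplex (ModuleCat.{v} F) ℤ :=
  subcomplex X.C (fun n => ⨆ p, X.filt p n) (by
    intro n n' c hc
    have hle : (⨆ p, X.filt p n) ≤ (⨆ p, X.filt p n').comap (X.C.d n n').hom :=
      iSup_le fun p c hc => (le_iSup (fun p => X.filt p n') p) (X.d_mem p n n' c hc)
    exact hle hc)

/-- Sequences `(s_n(i), m_n(i))_i` of length `K_n ≤ ∞` in `ℤ × {1, 2, …, ∞}`, for `n ∈ ℤ`, with a
decomposition of the persistent homology `H_n(PC)` into the graded `F[x]`-modules
`F[x] / (x ^ m_n(i)) {s_n(i)}` (which is `F[x] {s_n(i)}` if `m_n(i) = ∞`).  The index `i` starts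
from `0`. -/
structure Decomposition where
  K : ℤ → ℕ∞
  s : ∀ n, {i : ℕ // (i : ℕ∞) < K n} → ℤ
  m : ∀ n, {i : ℕ // (i : ℕ∞) < K n} → ℕ∞
  m_pos : ∀ n i, 1 ≤ m n i
  finite : ∀ n t, {i | s n i = t}.Finite
  s_mono : ∀ n i j, i ≤ j → s n i ≤ s n j
  m_mono : ∀ n i j, i ≤ j → s n i = s n j → m n i ≤ m n j
  iso : ∀ n, (X.PH n).Iso (GradedPolyModule.directSum fun i => cyclic F (s n i) (m n i))

/-- The multiplicity `ν_{n,s,m}` for `m ∈ {1, 2, …, ∞}`. -/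
noncomputable def Decomposition.nu {X : FilteredComplex.{u, v} F} (D : X.Decomposition)
    (n s : ℤ) (m : ℕ∞) : ℕ∞ :=
  {i | D.s n i = s ∧ D.m n i = m}.encard

end FilteredComplex

end PersistentSS

namespace PersistentSS

open CategoryTheory CategoryTheory.Limits

/-! Everything is reduced to counting bars. `exists_barBasis` splits a pointwise finite-dimensional
graded `F[x]`-module that vanishes in low degrees into cyclic modules. In degree `t` and for each
order `m` up to `∞`, one chooses generators of the `x ^ m`-torsion that are new, i.e. independent
modulo torsion of smaller order and multiples of `x`. The powers of `x` times these generators form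
a basis of every component. Any decomposition yields such a basis (`Decomposition.barBasis`), so the
formulas are proved for all decompositions at once.

In such a basis a power of `x` sends a basis element to a basis element or to zero. Hence
`b_n^{i,j}` is the number of bars that start in degree at most `i` and are alive in degree `j`
(`Decomposition.betti_eq`). Second differences of these counts isolate the bars with given start and
end, so they give `μ` (`mu_eq`). In the limit only the infinite bars survive (`totalBetti_eq`), and
their generators form a basis of the homology of the union (`rank_union_homology`).

The `A`-term of the couple derived `k` times is `x ^ k H(PC)`, so its dimensions and the ranks of
its map `f` are persistent Betti numbers. Exactness gives `dim E = dim coker f + dim ker f` in the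
appropriate degrees. In terms of bars (`finrank_couple_E`), a bar of length at least `k + 1`
contributes one dimension to homological degree `n` at its start and, if it is finite, one dimension
to degree `n + 1` at its end. Summing over the filtration degree (`pageDim_eq`), with `k = r - 1`,
gives both formulas. -/

/-! ### Sums and cardinalities in `ℕ∞` -/

theorem ENat.hasSum_iSup {ι : Type*} (f : ι → ℕ∞) :
    HasSum f (⨆ t : Finset ι, ∑ i ∈ t, f i) :=
  hasSum_of_isLUB _ isLUB_iSup

theorem ENat.summable {ι : Type*} (f : ι → ℕ∞) : Summable f :=
  (ENat.hasSum_iSup f).summable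

theorem ENat.tsum_add {ι : Type*} (f g : ι → ℕ∞) :
    ∑' i, (f i + g i) = ∑' i, f i + ∑' i, g i :=
  (ENat.summable f).tsum_add (ENat.summable g)

theorem sum_encard {α β : Type*} (S : β → Set α) (hS : Pairwise (Function.onFun Disjoint S))
    (t : Finset β) : ∑ b ∈ t, (S b).encard = (⋃ b ∈ t, S b).encard := by
  classical
  induction t using Finset.induction_on with
  | empty => simp
  | insert a t ha ih =>
    rw [Finset.sum_insert ha, ih, Finset.set_biUnion_insert, Set.encard_union_eq]
    rw [Set.disjoint_iUnion₂_right]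
    intro b hb
    exact hS (fun h => ha (h ▸ hb))

/-- An element of `ℕ∞` is determined by the natural numbers below it, and each natural number below
`S.encard` is the size of a finite subset; so infinite `S` needs no separate case. -/
theorem le_encard_of_forall_finset {α : Type*} {S : Set α} {c : ℕ∞}
    (h : ∀ t : Finset α, (t : Set α) ⊆ S → (t.card : ℕ∞) ≤ c) : S.encard ≤ c := by
  refine ENat.forall_natCast_le_iff_le.1 fun n hn => ?_
  obtain ⟨T, hTS, hT⟩ := Set.exists_subset_encard_eq hn
  have hfin : T.Finite := Set.finite_of_encard_eq_coe hT
  have := h hfin.toFinset (by simpa using hTS)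
  rwa [← Set.encard_coe_eq_coe_finsetCard, hfin.coe_toFinset, hT] at this

theorem tsum_encard {α β : Type*} (S : β → Set α) (hS : Pairwise (Function.onFun Disjoint S)) :
    ∑' b, (S b).encard = (⋃ b, S b).encard := by
  classical
  rw [(ENat.hasSum_iSup _).tsum_eq]
  refine le_antisymm (iSup_le fun t => ?_) (le_encard_of_forall_finset fun t ht => ?_)
  · rw [sum_encard S hS]
    exact Set.encard_le_encard (Set.iUnion₂_subset fun b _ => Set.subset_iUnion S b)
  · have hex : ∀ a : t, ∃ b, a.1 ∈ S b := fun a => Set.mem_iUnion.1 (ht a.2)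
    choose b hb using hex
    refine le_trans ?_ (le_iSup _ (t.attach.image b))
    rw [sum_encard S hS, ← Set.encard_coe_eq_coe_finsetCard]
    exact Set.encard_le_encard fun a ha =>
      Set.mem_iUnion₂.2 ⟨b ⟨a, ha⟩, Finset.mem_image_of_mem b (Finset.mem_attach _ _), hb ⟨a, ha⟩⟩

/-- The cardinality of a set is the sum of the cardinalities of the fibres of a map. -/
theorem tsum_encard_fiber {α β : Type*} (S : Set α) (R : β → Set α) (f : α → β)
    (hR : ∀ b a, a ∈ R b ↔ a ∈ S ∧ f a = b) : ∑' b, (R b).encard = S.encard := by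
  rw [tsum_encard R]
  · congr 1
    ext a
    simp [hR]
  · intro b c hbc
    refine Set.disjoint_left.2 fun a hb hc => hbc ?_
    rw [← ((hR b a).1 hb).2, ((hR c a).1 hc).2]

theorem toENat_rank_directSum {F : Type*} [Field F] {β : Type*} (V : β → Type*)
    [∀ b, AddCommGroup (V b)] [∀ b, Module F (V b)] [∀ b, FiniteDimensional F (V b)] :
    Cardinal.toENat (Module.rank F (DirectSum β V)) = ∑' b, (Module.finrank F (V b) : ℕ∞) := by
  classical
  have B : Module.Basis (Σ b, Fin (Module.finrank F (V b))) F (DirectSum β V) :=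
    DFinsupp.basis fun b => Module.finBasis F (V b)
  have h := B.mk_eq_rank
  have h2 := congrArg Cardinal.toENat h
  simp only [Cardinal.toENat_lift] at h2
  have hfib : ∀ b, (Module.finrank F (V b) : ℕ∞) =
      {a : Σ b, Fin (Module.finrank F (V b)) | a.1 = b}.encard := by
    intro b
    have : {a : Σ b, Fin (Module.finrank F (V b)) | a.1 = b} =
        Sigma.mk b '' (Set.univ : Set (Fin (Module.finrank F (V b)))) := by
      ext ⟨c, a⟩
      constructor
      · rintro rfl
        exact ⟨a, trivial, rfl⟩
      · rintro ⟨a', -, h⟩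
        exact (congrArg Sigma.fst h).symm
    rw [this, sigma_mk_injective.encard_image, Set.encard_univ]
    simp
  rw [← h2]
  simp only [hfib]
  rw [tsum_encard_fiber Set.univ _ Sigma.fst (by simp), Set.encard_univ]
  rfl

/-! ### Bar bases of graded modules -/

/-- The bars that start in degree at most `i` and are alive in degree `j`. -/
def bars {ι : Type*} (s : ι → ℤ) (m : ι → ℕ∞) (i j : ℤ) : Set ι :=
  {k | s k ≤ i ∧ ((j - s k).toNat : ℕ∞) < m k}

/-- Homogeneous elements `e k p` (the `x ^ (p - s k)`-multiples of generators in degrees `s k`)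
which exhibit a graded `F[x]`-module as a direct sum of cyclic modules of orders `m k`. -/
structure BarBasis {F : Type u} [Field F] (M : GradedPolyModule.{u, v} F) {ι : Type w}
    (s : ι → ℤ) (m : ι → ℕ∞) where
  -- The values in degrees `p < s k` are junk: none of the conditions below refers to them.
  e : ι → ∀ p, M.comp p
  x_e : ∀ k p, s k ≤ p → M.x p (e k p) = e k (p + 1)
  e_eq_zero : ∀ k p, s k ≤ p → m k ≤ ((p - s k).toNat : ℕ∞) → e k p = 0
  linearIndependent : ∀ p, LinearIndependent F fun k : bars s m p p => e k p
  span : ∀ p, ⊤ ≤ Submodule.span F (Set.range fun k : bars s m p p => e k p)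

namespace BarBasis

variable {F : Type u} [Field F] {M : GradedPolyModule.{u, v} F} {N : GradedPolyModule.{u, w} F}
  {ι κ : Type*} {s : ι → ℤ} {m : ι → ℕ∞}

/-- The basis of the component of degree `p`. -/
noncomputable def basis (B : BarBasis M s m) (p : ℤ) :
    Module.Basis (bars s m p p) F (M.comp p) :=
  Module.Basis.mk (B.linearIndependent p) (B.span p)

theorem basis_apply (B : BarBasis M s m) (p : ℤ) (k : bars s m p p) : B.basis p k = B.e k p := by
  simp [basis]

/-- Graded modules with bar bases of the same type are isomorphic. -/
noncomputable def iso (B : BarBasis M s m) (C : BarBasis N s m) : M.Iso N where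
  equiv p := (B.basis p).equiv (C.basis p) (Equiv.refl _)
  comm p a := by
    have key : ((B.basis (p + 1)).equiv (C.basis (p + 1)) (Equiv.refl _)).toLinearMap ∘ₗ M.x p =
        N.x p ∘ₗ ((B.basis p).equiv (C.basis p) (Equiv.refl _)).toLinearMap := by
      refine (B.basis p).ext fun k => ?_
      simp only [LinearMap.comp_apply, LinearEquiv.coe_coe, Module.Basis.equiv_apply,
        Equiv.refl_apply]
      rw [basis_apply, basis_apply, B.x_e _ _ k.2.1, C.x_e _ _ k.2.1]
      -- The bar may end in degree `p + 1`; then both sides vanish.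
      by_cases hk : (k : ι) ∈ bars s m (p + 1) (p + 1)
      · have := (B.basis (p + 1)).equiv_apply ⟨k, hk⟩ (C.basis (p + 1)) (Equiv.refl _)
        rwa [basis_apply, Equiv.refl_apply, basis_apply] at this
      · have h1 : s k ≤ p + 1 := k.2.1.trans (by omega)
        have h2 : m k ≤ ((p + 1 - s k).toNat : ℕ∞) := not_lt.1 fun h => hk ⟨h1, h⟩
        rw [B.e_eq_zero _ _ h1 h2, C.e_eq_zero _ _ h1 h2, map_zero]
    exact LinearMap.congr_fun key a

/-- Transport of a bar basis along an isomorphism. -/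
def ofIso (f : M.Iso N) (B : BarBasis N s m) : BarBasis M s m where
  e k p := (f.equiv p).symm (B.e k p)
  x_e k p hp := by
    rw [LinearEquiv.eq_symm_apply, f.comm, LinearEquiv.apply_symm_apply, B.x_e k p hp]
  e_eq_zero k p hp hm := by rw [B.e_eq_zero k p hp hm, map_zero]
  linearIndependent p := (B.linearIndependent p).map' (f.equiv p).symm.toLinearMap
    (LinearEquiv.ker _)
  span p := by
    have h : Set.range (fun k : bars s m p p => (f.equiv p).symm (B.e k p)) =
        (f.equiv p).symm.toLinearMap '' Set.range (fun k : bars s m p p => B.e k p) := by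
      rw [← Set.range_comp]; rfl
    rw [h, Submodule.span_image, top_le_iff.1 (B.span p), Submodule.map_top, LinearEquiv.range]

/-- Reindexing of a bar basis. -/
def reindex (σ : κ ≃ ι) (B : BarBasis M s m) : BarBasis M (s ∘ σ) (m ∘ σ) where
  e k := B.e (σ k)
  x_e k := B.x_e (σ k)
  e_eq_zero k := B.e_eq_zero (σ k)
  linearIndependent p := (B.linearIndependent p).comp
    (fun k : bars (s ∘ σ) (m ∘ σ) p p => (⟨σ k, k.2⟩ : bars s m p p))
    fun k l h => Subtype.ext (σ.injective (congrArg Subtype.val h))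
  span p := by
    refine (B.span p).trans (Submodule.span_mono ?_)
    rintro _ ⟨k, rfl⟩
    exact ⟨⟨σ.symm k, by simpa [bars] using k.2⟩, by simp⟩

end BarBasis

/-! ### Direct sums of cyclic modules -/

theorem powIdeal_top (F : Type u) [Field F] : powIdeal F ⊤ = ⊥ := by
  simp only [powIdeal, ENat.natCast_ne_top, false_and, exists_false, Set.ofPred_false,
    Ideal.span_empty]

theorem powIdeal_natCast (F : Type u) [Field F] (m : ℕ) :
    powIdeal F m = Ideal.span {Polynomial.X ^ m} := by
  have : {a : Polynomial F | ∃ j : ℕ, (j : ℕ∞) = m ∧ a = Polynomial.X ^ j} =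
      {Polynomial.X ^ m} := by
    ext a
    simp [Nat.cast_inj]
  rw [powIdeal, this]

theorem X_pow_mem_powIdeal (F : Type u) [Field F] (m : ℕ∞) (j : ℕ) :
    (Polynomial.X ^ j : Polynomial F) ∈ powIdeal F m ↔ m ≤ j := by
  induction m using ENat.recTopCoe with
  | top => simp [powIdeal_top]
  | coe m =>
    rw [powIdeal_natCast, Ideal.mem_span_singleton,
      pow_dvd_pow_iff Polynomial.X_ne_zero Polynomial.not_isUnit_X, Nat.cast_le]

theorem X_pow_mem_cyclicComp (F : Type u) [Field F] (s : ℤ) (m : ℕ∞) (p : ℤ) (j : ℕ)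
    (hj : p = s + j) :
    (Ideal.Quotient.mk (powIdeal F m) (Polynomial.X ^ j)) ∈ cyclicComp F s m p :=
  Submodule.subset_span ⟨j, hj, rfl⟩

open Classical in
/-- The element `x ^ (p - s)` of degree `p` in `F[x] / (x ^ m) {s}`, and `0` for `p < s`. -/
noncomputable def cyclicElem (F : Type u) [Field F] (s : ℤ) (m : ℕ∞) (p : ℤ) :
    cyclicComp F s m p :=
  if h : s ≤ p then
    ⟨Ideal.Quotient.mk (powIdeal F m) (Polynomial.X ^ (p - s).toNat),
      X_pow_mem_cyclicComp F s m p _ (by omega)⟩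
  else 0

theorem cyclicElem_of_le (F : Type u) [Field F] {s : ℤ} {m : ℕ∞} {p : ℤ} (hp : s ≤ p) :
    cyclicElem F s m p =
      ⟨Ideal.Quotient.mk (powIdeal F m) (Polynomial.X ^ (p - s).toNat),
        X_pow_mem_cyclicComp F s m p _ (by omega)⟩ :=
  dif_pos hp

theorem cyclicElem_of_not_le (F : Type u) [Field F] {s : ℤ} {m : ℕ∞} {p : ℤ} (hp : ¬ s ≤ p) :
    cyclicElem F s m p = 0 :=
  dif_neg hp

theorem cyclicElem_eq_zero (F : Type u) [Field F] {s : ℤ} {m : ℕ∞} {p : ℤ} (hp : s ≤ p) :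
    cyclicElem F s m p = 0 ↔ m ≤ ((p - s).toNat : ℕ∞) := by
  rw [cyclicElem_of_le F hp, ← X_pow_mem_powIdeal F, ← Ideal.Quotient.eq_zero_iff_mem]
  exact Subtype.ext_iff

theorem x_cyclicElem (F : Type u) [Field F] {s : ℤ} {m : ℕ∞} {p : ℤ} (hp : s ≤ p) :
    (cyclic F s m).x p (cyclicElem F s m p) = cyclicElem F s m (p + 1) := by
  rw [cyclicElem_of_le F hp, cyclicElem_of_le F (by omega)]
  refine Subtype.ext ?_
  change Ideal.Quotient.mk (powIdeal F m) Polynomial.X * Ideal.Quotient.mk (powIdeal F m) _ =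
    Ideal.Quotient.mk (powIdeal F m) _
  rw [← map_mul, ← pow_succ']
  congr 2
  omega

theorem exists_smul_cyclicElem (F : Type u) [Field F] (s : ℤ) (m : ℕ∞) (p : ℤ)
    (a : cyclicComp F s m p) : ∃ c : F, c • cyclicElem F s m p = a := by
  suffices h : cyclicComp F s m p ≤ Submodule.span F {(cyclicElem F s m p : _ ⧸ _)} by
    obtain ⟨c, hc⟩ := Submodule.mem_span_singleton.1 (h a.2)
    exact ⟨c, Subtype.ext hc⟩
  refine Submodule.span_le.2 ?_
  rintro _ ⟨j, hj, rfl⟩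
  refine Submodule.subset_span ?_
  rw [cyclicElem_of_le F (by omega), Set.mem_singleton_iff]
  congr 2
  omega

theorem linearIndependent_lof {F : Type*} [Field F] {ι : Type*} [DecidableEq ι] {W : ι → Type*}
    [∀ i, AddCommGroup (W i)] [∀ i, Module F (W i)] (a : ∀ i, W i) (P : Set ι)
    (ha : ∀ i ∈ P, a i ≠ 0) :
    LinearIndependent F fun k : P => DirectSum.lof F ι W k (a k) := by
  rw [linearIndependent_iff']
  intro t g h k hk
  have h1 := congrArg (DirectSum.component F ι W k) h
  rw [map_sum, map_zero, Finset.sum_eq_single k] at h1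
  · rw [map_smul, DirectSum.component.lof_self] at h1
    exact (smul_eq_zero.1 h1).resolve_right (ha k k.2)
  · intro l _ hl
    rw [map_smul, DirectSum.component.of, dif_neg (fun h => hl (Subtype.ext h)), smul_zero]
  · exact fun h => absurd hk h

theorem span_lof {F : Type*} [Field F] {ι : Type*} [DecidableEq ι] {W : ι → Type*}
    [∀ i, AddCommGroup (W i)] [∀ i, Module F (W i)] (a : ∀ i, W i) (P : Set ι)
    (ha : ∀ i ∉ P, a i = 0) (hspan : ∀ i (b : W i), ∃ c : F, c • a i = b) :
    ⊤ ≤ Submodule.span F (Set.range fun k : P => DirectSum.lof F ι W k (a k)) := by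
  rintro b -
  induction b using DirectSum.induction_on with
  | zero => exact Submodule.zero_mem _
  | add a b iha ihb => exact Submodule.add_mem _ iha ihb
  | of k b =>
    obtain ⟨c, rfl⟩ := hspan k b
    change DirectSum.lof F ι W k _ ∈ _
    rw [map_smul]
    refine Submodule.smul_mem _ _ ?_
    by_cases hk : k ∈ P
    · exact Submodule.subset_span ⟨⟨k, hk⟩, rfl⟩
    · rw [ha k hk, map_zero]
      exact Submodule.zero_mem _

theorem cyclicElem_eq_zero_of_notMem (F : Type u) [Field F] {ι : Type} (s : ι → ℤ) (m : ι → ℕ∞)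
    (p : ℤ) (k : ι) (hk : k ∉ bars s m p p) : cyclicElem F (s k) (m k) p = 0 := by
  by_cases hp : s k ≤ p
  · exact (cyclicElem_eq_zero F hp).2 (not_lt.1 fun h => hk ⟨hp, h⟩)
  · exact cyclicElem_of_not_le F hp

theorem linearIndependent_cyclicElem (F : Type u) [Field F] {ι : Type} [DecidableEq ι]
    (s : ι → ℤ) (m : ι → ℕ∞) (p : ℤ) :
    LinearIndependent F fun k : bars s m p p =>
      DirectSum.lof F ι (fun i => cyclicComp F (s i) (m i) p) k (cyclicElem F (s k) (m k) p) :=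
  linearIndependent_lof (fun i => cyclicElem F (s i) (m i) p) _
    fun _ hk h => absurd hk.2 (not_lt.2 ((cyclicElem_eq_zero F hk.1).1 h))

theorem span_cyclicElem (F : Type u) [Field F] {ι : Type} [DecidableEq ι]
    (s : ι → ℤ) (m : ι → ℕ∞) (p : ℤ) :
    ⊤ ≤ Submodule.span F (Set.range fun k : bars s m p p =>
      DirectSum.lof F ι (fun i => cyclicComp F (s i) (m i) p) k
        (cyclicElem F (s k) (m k) p)) :=
  span_lof (fun i => cyclicElem F (s i) (m i) p) _
    (cyclicElem_eq_zero_of_notMem F s m p) fun i => exists_smul_cyclicElem F (s i) (m i) p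

open Classical in
/-- The bar basis of a direct sum of cyclic modules. -/
noncomputable def cyclicBarBasis (F : Type u) [Field F] {ι : Type} (s : ι → ℤ) (m : ι → ℕ∞) :
    BarBasis (GradedPolyModule.directSum fun i => cyclic F (s i) (m i)) s m where
  e k p := DirectSum.lof F ι (fun i => cyclicComp F (s i) (m i) p) k
      (cyclicElem F (s k) (m k) p)
  x_e k p hp := (DirectSum.lmap_lof _ _ _).trans
    (congrArg (DirectSum.lof F ι (fun i => cyclicComp F (s i) (m i) (p + 1)) k)
      (x_cyclicElem F hp))
  e_eq_zero k p hp hm := (congrArg (DirectSum.lof F ι (fun i => cyclicComp F (s i) (m i) p) k)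
    ((cyclicElem_eq_zero F hp).2 hm)).trans (map_zero _)
  linearIndependent p := linearIndependent_cyclicElem F s m p
  span p := span_cyclicElem F s m p

/-! ### Ranks of multiplication by powers of `x` -/

/-- The maps `φ p q` are the multiplications by `x ^ (q - p)` on the graded module `M`. -/
structure GradedPolyModule.IsTransition {F : Type u} [Field F] (M : GradedPolyModule.{u, v} F)
    (φ : ∀ p q : ℤ, p ≤ q → M.comp p →ₗ[F] M.comp q) : Prop where
  refl : ∀ p (h : p ≤ p) a, φ p p h a = a
  trans : ∀ p q r (h : p ≤ q) (h' : q ≤ r) a, φ q r h' (φ p q h a) = φ p r (h.trans h') a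
  step : ∀ p (h : p ≤ p + 1) a, φ p (p + 1) h a = M.x p a

theorem bars_subset {ι : Type*} {s : ι → ℤ} {m : ι → ℕ∞} {i i' j : ℤ} (h : i ≤ i') :
    bars s m i j ⊆ bars s m i' j :=
  fun _ hk => ⟨hk.1.trans h, hk.2⟩

section

variable {F : Type u} [Field F] {M : GradedPolyModule.{u, v} F}
  {φ : ∀ p q : ℤ, p ≤ q → M.comp p →ₗ[F] M.comp q}

namespace BarBasis

variable {ι : Type*} {s : ι → ℤ} {m : ι → ℕ∞}

theorem map_e (B : BarBasis M s m) (hφ : M.IsTransition φ) (k : ι) (p q : ℤ) (hp : s k ≤ p)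
    (hpq : p ≤ q) : φ p q hpq (B.e k p) = B.e k q := by
  induction q, hpq using Int.leInduction with
  | base => exact hφ.refl p _ _
  | succ q hpq ih => rw [← hφ.trans p q (q + 1) hpq (by omega), ih, hφ.step, B.x_e k q (by omega)]

theorem range_eq_span (B : BarBasis M s m) (hφ : M.IsTransition φ) (p q : ℤ) (hpq : p ≤ q) :
    LinearMap.range (φ p q hpq) =
      Submodule.span F (Set.range fun k : bars s m p q => B.e k q) := by
  refine le_antisymm ?_ (Submodule.span_le.2 ?_)
  · rw [LinearMap.range_eq_map, ← top_le_iff.1 (B.span p), Submodule.map_span,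
      Submodule.span_le]
    rintro _ ⟨_, ⟨k, rfl⟩, rfl⟩
    have hk : s k ≤ p := k.2.1
    simp only
    rw [B.map_e hφ k p q hk hpq]
    by_cases hm : ((q - s k).toNat : ℕ∞) < m k
    · exact Submodule.subset_span ⟨⟨k, hk, hm⟩, rfl⟩
    · rw [B.e_eq_zero k q (hk.trans hpq) (not_lt.1 hm)]
      exact Submodule.zero_mem _
  · rintro _ ⟨k, rfl⟩
    exact ⟨B.e k p, B.map_e hφ k p q k.2.1 hpq⟩

theorem linearIndependent_bars (B : BarBasis M s m) (p q : ℤ) (hpq : p ≤ q) :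
    LinearIndependent F fun k : bars s m p q => B.e k q :=
  (B.linearIndependent q).comp (fun k : bars s m p q => ⟨k, bars_subset hpq k.2⟩)
    fun _ _ h => Subtype.ext (congrArg (fun a => a.1) h)

theorem finite_bars (B : BarBasis M s m) (p q : ℤ) (hpq : p ≤ q)
    [FiniteDimensional F (M.comp q)] : (bars s m p q).Finite :=
  (Set.finite_coe_iff.1 (B.linearIndependent_bars p q hpq).finite)

/-- The image is spanned by the degree-`q` elements of the bars that have started by degree `p` and
are still alive in degree `q`. They belong to the basis in degree `q`, so the rank counts them. -/
theorem finrank_range (B : BarBasis M s m) (hφ : M.IsTransition φ) (p q : ℤ) (hpq : p ≤ q) :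
    Module.finrank F (LinearMap.range (φ p q hpq)) = (bars s m p q).ncard := by
  rw [B.range_eq_span hφ, Module.finrank, rank_span (B.linearIndependent_bars p q hpq)]
  exact (Nat.card_range_of_injective (B.linearIndependent_bars p q hpq).injective).trans
    (Nat.card_coe_set_eq _)

end BarBasis

/-! ### Existence of bar bases -/

/-- A complement of `K ⊓ W` in the whole space, intersected with `K`, works by the modular law. -/
theorem exists_relative_complement {V : Type*} [AddCommGroup V] [Module F V]
    (K W : Submodule F V) : ∃ G ≤ K, Disjoint G W ∧ K ≤ G ⊔ W := by
  obtain ⟨C, hC⟩ := exists_isCompl (K ⊓ W)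
  refine ⟨C ⊓ K, inf_le_right, ?_, ?_⟩
  · rw [disjoint_iff, inf_assoc, inf_comm, hC.inf_eq_bot]
  · have h : K ⊓ C ⊔ K ⊓ W = K := by
      rw [sup_comm, ← inf_comm C K, ← sup_inf_assoc_of_le C (inf_le_left : K ⊓ W ≤ K),
        hC.sup_eq_top, top_inf_eq]
    calc K = K ⊓ C ⊔ K ⊓ W := h.symm
      _ ≤ C ⊓ K ⊔ W := sup_le_sup (inf_comm K C).le inf_le_right

variable (φ) in
/-- The elements of degree `t` that are annihilated by `x ^ m` (where `x ^ ∞ = 0`). -/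
def annihilated (t : ℤ) (m : ℕ∞) : Submodule F (M.comp t) :=
  ⨅ (q : ℤ) (h : t ≤ q) (_ : m ≤ ((q - t).toNat : ℕ∞)), LinearMap.ker (φ t q h)

theorem mem_annihilated {t : ℤ} {m : ℕ∞} {a : M.comp t} :
    a ∈ annihilated φ t m ↔
      ∀ q (h : t ≤ q), m ≤ ((q - t).toNat : ℕ∞) → φ t q h a = 0 := by
  simp [annihilated, Submodule.mem_iInf]

/-- The condition is vacuous for `m = ∞`. This lets infinite bars arise from the same construction
as finite ones. -/
theorem annihilated_top (t : ℤ) : annihilated φ t ⊤ = ⊤ :=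
  top_le_iff.1 fun _ _ => mem_annihilated.2 fun _ _ h =>
    absurd (top_le_iff.1 h) (ENat.natCast_ne_top _)

theorem annihilated_zero (hφ : M.IsTransition φ) (t : ℤ) : annihilated φ t 0 = ⊥ :=
  le_bot_iff.1 fun a ha => by
    have := mem_annihilated.1 ha t le_rfl (zero_le)
    rwa [hφ.refl] at this

theorem mem_annihilated_of_eq_zero (hφ : M.IsTransition φ) {t q : ℤ} (h : t ≤ q) {a : M.comp t}
    (ha : φ t q h a = 0) : a ∈ annihilated φ t ((q - t).toNat : ℕ∞) := by
  refine mem_annihilated.2 fun r hr hm => ?_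
  have : q ≤ r := by
    have := Nat.cast_le.1 hm
    omega
  rw [← hφ.trans t q r h this, ha, map_zero]

variable (φ) in
/-- The elements of degree `t` that are sums of elements annihilated by lower powers than `x ^ m`
and of multiples of `x`. -/
def decomposed (t : ℤ) (m : ℕ∞) : Submodule F (M.comp t) :=
  (⨆ (m' : ℕ∞) (_ : m' < m), annihilated φ t m') ⊔ LinearMap.range (φ (t - 1) t (by omega))

theorem annihilated_le_decomposed {t : ℤ} {m m' : ℕ∞} (h : m' < m) :
    annihilated φ t m' ≤ decomposed φ t m :=
  le_trans (le_iSup₂ (f := fun (m' : ℕ∞) (_ : m' < m) => annihilated φ t m') m' h) le_sup_left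

theorem map_mem_decomposed (hφ : M.IsTransition φ) {t t' : ℤ} (h : t' < t) (m : ℕ∞)
    (a : M.comp t') : φ t' t h.le a ∈ decomposed φ t m := by
  refine Submodule.mem_sup_right ⟨φ t' (t - 1) (by omega) a, ?_⟩
  rw [hφ.trans]

/-- A pointwise finite-dimensional graded module that vanishes in low degrees has a bar basis. -/
theorem exists_barBasis (hφ : M.IsTransition φ) [∀ p, FiniteDimensional F (M.comp p)] (p₀ : ℤ)
    (hp₀ : ∀ p ≤ p₀, ∀ a : M.comp p, a = 0) :
    ∃ (ι : Type) (s : ι → ℤ) (m : ι → ℕ∞), (∀ k, 1 ≤ m k) ∧ Nonempty (BarBasis M s m) := by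
  classical
  -- `G t m` is the space of new generators of degree `t` and order `m`: it complements what is
  -- already accounted for by smaller orders and lower degrees.
  choose G hGK hdis hGsup using fun (t : ℤ) (m : ℕ∞) =>
    exists_relative_complement (annihilated φ t m) (decomposed φ t m)
  let ι := Σ t : ℤ, Σ m : ℕ∞, Fin (Module.finrank F (G t m))
  let g : ∀ k : ι, M.comp k.1 := fun k => (Module.finBasis F (G k.1 k.2.1) k.2.2 : G k.1 k.2.1)
  have hgG : ∀ k : ι, g k ∈ G k.1 k.2.1 := fun k => SetLike.coe_mem _
  have hgK : ∀ k : ι, g k ∈ annihilated φ k.1 k.2.1 := fun k => hGK _ _ (hgG k)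
  let e : ∀ (k : ι) (p : ℤ), M.comp p := fun k p => if h : k.1 ≤ p then φ k.1 p h (g k) else 0
  have he : ∀ (k : ι) p (h : k.1 ≤ p), e k p = φ k.1 p h (g k) := fun k p h => dif_pos h
  have he0 : ∀ (k : ι) p, ¬ k.1 ≤ p → e k p = 0 := fun k p h => dif_neg h
  have hmap : ∀ (k : ι) p q (h : p ≤ q), k.1 ≤ p → φ p q h (e k p) = e k q := fun k p q h hk => by
    rw [he k p hk, he k q (hk.trans h), hφ.trans]
  have hzero : ∀ (k : ι) p, k.1 ≤ p → k.2.1 ≤ ((p - k.1).toNat : ℕ∞) → e k p = 0 :=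
    fun k p h hm => by rw [he k p h]; exact mem_annihilated.1 (hgK k) p h hm
  have hGspan : ∀ t m, G t m ≤ Submodule.span F (Set.range fun k => e k t) := by
    intro t m
    have h1 : G t m = (Submodule.span F (Set.range (Module.finBasis F (G t m)))).map
        (G t m).subtype := by
      rw [Module.Basis.span_eq, Submodule.map_top, Submodule.range_subtype]
    rw [h1, Submodule.map_span, Submodule.span_le]
    rintro _ ⟨_, ⟨a, rfl⟩, rfl⟩
    refine Submodule.subset_span ⟨⟨t, m, a⟩, ?_⟩
    simp only
    rw [he _ t le_rfl, hφ.refl]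
    rfl
  have hspan : ∀ p, ⊤ ≤ Submodule.span F (Set.range fun k => e k p) := by
    intro p
    rcases le_total p p₀ with hp | hp
    · intro a _
      rw [hp₀ p hp a]
      exact Submodule.zero_mem _
    induction p, hp using Int.leInduction with
    | base =>
      intro a _
      rw [hp₀ p₀ le_rfl a]
      exact Submodule.zero_mem _
    | succ p hp ih =>
      have hI : LinearMap.range (φ (p + 1 - 1) (p + 1) (by omega)) ≤
          Submodule.span F (Set.range fun k => e k (p + 1)) := by
        have key : ∀ q (h : q ≤ p + 1), q = p → LinearMap.range (φ q (p + 1) h) ≤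
            Submodule.span F (Set.range fun k => e k (p + 1)) := by
          rintro q h rfl
          rw [LinearMap.range_eq_map, ← top_le_iff.1 ih, Submodule.map_span, Submodule.span_le]
          rintro _ ⟨_, ⟨k, rfl⟩, rfl⟩
          by_cases hk : k.1 ≤ q
          · exact Submodule.subset_span ⟨k, (hmap k q (q + 1) h hk).symm⟩
          · simp only
            rw [he0 k q hk, map_zero]
            exact Submodule.zero_mem _
        exact key _ _ (by omega)
      have hK : ∀ m, annihilated φ (p + 1) m ≤
          Submodule.span F (Set.range fun k => e k (p + 1)) := by
        intro m
        -- `ℕ∞` is well-ordered, so this induction reaches `m = ∞`, where the annihilated part is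
        -- the whole component.
        induction m using WellFoundedLT.induction with
        | ind m ihm =>
          refine (hGsup _ _).trans (sup_le (hGspan _ _) (sup_le (iSup₂_le ihm) hI))
      exact annihilated_top (φ := φ) (p + 1) ▸ hK ⊤
  have hone : ∀ k : ι, 1 ≤ k.2.1 := by
    rintro ⟨t, m, a⟩
    refine Order.one_le_iff_ne_zero.2 fun hm => ?_
    simp only at hm
    subst hm
    have h1 := hgK ⟨t, 0, a⟩
    rw [annihilated_zero hφ, Submodule.mem_bot] at h1
    exact (Module.finBasis F (G t 0)).ne_zero a (Subtype.ext h1)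
  refine ⟨ι, fun k => k.1, fun k => k.2.1, hone, ⟨⟨e, ?_, hzero, ?_, ?_⟩⟩⟩
  · intro k p hk
    rw [← hφ.step p (by omega)]
    exact hmap k p (p + 1) _ hk
  · intro p
    rw [linearIndependent_iff']
    intro T c hsum k hk
    by_contra hck
    -- a lexicographically largest bar with a nonzero coefficient
    let T' := T.filter fun k => c k ≠ 0
    obtain ⟨⟨⟨t, μ, a⟩, hk₀p⟩, hk₀, hmax⟩ := T'.exists_max_image (fun k => toLex ((k : ι).1, (k : ι).2.1))
      ⟨k, Finset.mem_filter.2 ⟨hk, hck⟩⟩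
    have htp : t ≤ p := hk₀p.1
    have hle : ∀ k ∈ T', k.1.1 ≤ t := fun k hk => by
      rcases Prod.Lex.toLex_le_toLex.1 (hmax k hk) with h | h
      exacts [h.le, h.1.le]
    -- All bars involved have started by degree `t`, so the relation lifts to an element of degree
    -- `t` killed by `x ^ (p - t)`. Since the bar `(t, μ)` is alive in degree `p`, we have `p - t <
    -- μ`.
    have hsum' : ∑ k ∈ T', c k • e k t ∈ decomposed φ t μ := by
      refine annihilated_le_decomposed hk₀p.2 (mem_annihilated_of_eq_zero hφ htp ?_)
      rw [map_sum, ← hsum]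
      refine Finset.sum_subset_zero_on_sdiff (Finset.filter_subset _ _) (fun k hk => ?_)
        fun k hk => ?_
      · have : c k = 0 := by
          by_contra h
          exact (Finset.mem_sdiff.1 hk).2 (Finset.mem_filter.2 ⟨(Finset.mem_sdiff.1 hk).1, h⟩)
        rw [this, zero_smul]
      · rw [map_smul, hmap k t p htp (hle k hk)]
    let P : bars (fun k : ι => k.1) (fun k : ι => k.2.1) p p → Prop :=
      fun k => k.1.1 = t ∧ k.1.2.1 = μ
    -- By maximality the other bars start earlier, which gives multiples of `x`, or start in degree
    -- `t` with smaller order.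
    have hrest : ∑ k ∈ T' with ¬ P k, c k • e k t ∈ decomposed φ t μ := by
      refine Submodule.sum_mem _ fun k hk => Submodule.smul_mem _ _ ?_
      obtain ⟨hkT, hkP⟩ := Finset.mem_filter.1 hk
      rcases Prod.Lex.toLex_le_toLex.1 (hmax k hkT) with h | h
      · rw [he k t h.le]
        exact map_mem_decomposed hφ h μ _
      · obtain ⟨⟨t', μ', a'⟩, hk'⟩ := k
        obtain rfl : t' = t := h.1
        have hμ : μ' < μ := lt_of_le_of_ne h.2 fun h' => hkP ⟨rfl, h'⟩
        rw [he _ t' le_rfl, hφ.refl]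
        exact annihilated_le_decomposed hμ (hgK ⟨t', μ', a'⟩)
    -- This sum lies in `G t μ` and, as a difference of the two previous sums, in `decomposed φ t
    -- μ`; the two spaces are disjoint.
    have htop : ∑ k ∈ T' with P k, c k • e k t = 0 := by
      refine Submodule.disjoint_def.1 (hdis t μ) _ ?_ ?_
      · refine Submodule.sum_mem _ fun k hk => Submodule.smul_mem _ _ ?_
        obtain ⟨⟨t', μ', a'⟩, hk'⟩ := k
        obtain ⟨h1, h2⟩ := (Finset.mem_filter.1 hk).2
        obtain rfl : t' = t := h1
        obtain rfl : μ' = μ := h2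
        rw [he _ t' le_rfl, hφ.refl]
        exact hgG ⟨t', μ', a'⟩
      · rw [← Finset.sum_filter_add_sum_filter_not T' P] at hsum'
        exact (Submodule.add_mem_iff_left _ hrest).1 hsum'
    let j : Fin (Module.finrank F (G t μ)) → bars (fun k : ι => k.1) (fun k : ι => k.2.1) p p :=
      fun b => ⟨⟨t, μ, b⟩, hk₀p⟩
    have hj : Function.Injective j := fun b b' h => by
      have h' : (⟨t, μ, b⟩ : ι) = ⟨t, μ, b'⟩ := congrArg Subtype.val h
      cases h'
      rfl
    have hli : LinearIndependent F fun b => e (j b) t := by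
      have h1 := (Module.finBasis F (G t μ)).linearIndependent.map' (G t μ).subtype
        (Submodule.ker_subtype _)
      have h2 : (fun b => e (j b) t) = (G t μ).subtype ∘ Module.finBasis F (G t μ) := by
        funext b
        rw [he (j b) t le_rfl, hφ.refl]
        rfl
      rw [h2]
      exact h1
    refine (Finset.mem_filter.1 hk₀).2 (linearIndependent_iff'.1 hli
      ((T'.filter P).preimage j hj.injOn) (fun b => c (j b)) ?_ a ?_)
    · rw [Finset.sum_preimage j (T'.filter P) hj.injOn (fun k => c k • e k t), htop]
      rintro ⟨⟨t', μ', a'⟩, hk'⟩ hk hkj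
      obtain ⟨h1, h2⟩ := (Finset.mem_filter.1 hk).2
      obtain rfl : t' = t := h1
      obtain rfl : μ' = μ := h2
      exact absurd ⟨a', rfl⟩ hkj
    · exact Finset.mem_preimage.2 (Finset.mem_filter.2 ⟨hk₀, rfl, rfl⟩)
  · intro p
    refine (hspan p).trans (Submodule.span_le.2 ?_)
    rintro _ ⟨k, rfl⟩
    simp only
    by_cases hk : k.1 ≤ p
    · by_cases hm : k.2.1 ≤ ((p - k.1).toNat : ℕ∞)
      · rw [hzero k p hk hm]
        exact Submodule.zero_mem _
      · exact Submodule.subset_span ⟨⟨k, hk, not_le.1 hm⟩, rfl⟩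
    · rw [he0 k p hk]
      exact Submodule.zero_mem _

end

/-! ### Enumeration of bars in lexicographic order -/

/-- A linear order with finite initial segments is isomorphic to an initial segment of `ℕ`. -/
theorem exists_strictMono_equiv {ι : Type*} [LinearOrder ι] (h : ∀ a : ι, (Set.Iio a).Finite) :
    ∃ (K : ℕ∞) (σ : {i : ℕ // (i : ℕ∞) < K} ≃ ι), StrictMono σ := by
  let r : ι → ℕ := fun a => (Set.Iio a).ncard
  have hr : StrictMono r := fun a b hab =>
    Set.ncard_lt_ncard ((Set.ssubset_iff_of_subset (Set.Iio_subset_Iio hab.le)).2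
      ⟨a, hab, lt_irrefl a⟩) (h b)
  have himage : ∀ a, r '' Set.Iio a = Set.Iio (r a) := fun a => by
    refine Set.eq_of_subset_of_ncard_le ?_ ?_ (Set.finite_Iio _)
    · rintro _ ⟨b, hb, rfl⟩
      exact hr hb
    · rw [Set.ncard_image_of_injective _ hr.injective, ← Finset.coe_Iio, Set.ncard_coe_finset,
        Nat.card_Iio]
  have hlt : ∀ a, (r a : ℕ∞) < (Set.univ : Set ι).encard := fun a => by
    have h1 : (Set.Iic a).encard = ((r a + 1 : ℕ) : ℕ∞) := by
      rw [← Set.Iio_insert, Set.encard_insert_of_notMem (by simp), ← (h a).cast_ncard_eq]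
      rfl
    refine lt_of_lt_of_le ?_ (Set.encard_le_encard (Set.subset_univ (Set.Iic a)))
    rw [h1, Nat.cast_lt]
    exact Nat.lt_succ_self _
  -- Among `n + 1` elements, whose ranks are distinct, one has rank at least `n`; by `himage` every
  -- rank below that one is attained.
  have hsurj : ∀ n : ℕ, (n : ℕ∞) < (Set.univ : Set ι).encard → ∃ a, r a = n := fun n hn => by
    have h1 : ((n + 1 : ℕ) : ℕ∞) ≤ (Set.univ : Set ι).encard := by
      push_cast
      exact Order.add_one_le_of_lt hn
    obtain ⟨T, -, hT⟩ := Set.exists_subset_encard_eq h1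
    have hex : ∃ a ∈ T, n ≤ r a := by
      by_contra! hcon
      have h2 : r '' T ⊆ Set.Iio n := by
        rintro _ ⟨a, ha, rfl⟩
        exact hcon a ha
      have h3 := Set.encard_le_encard h2
      rw [hr.injective.encard_image, hT, ← Finset.coe_Iio, Set.encard_coe_eq_coe_finsetCard,
        Nat.card_Iio, Nat.cast_le] at h3
      omega
    obtain ⟨a, -, ha⟩ := hex
    rcases ha.eq_or_lt with ha | ha
    · exact ⟨a, ha.symm⟩
    · obtain ⟨b, -, hb⟩ := (himage a).symm ▸ (Set.mem_Iio.2 ha)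
      exact ⟨b, hb⟩
  let τ : ι ≃ {i : ℕ // (i : ℕ∞) < (Set.univ : Set ι).encard} :=
    Equiv.ofBijective (fun a => ⟨r a, hlt a⟩)
      ⟨fun a b hab => hr.injective (congrArg Subtype.val hab),
        fun ⟨n, hn⟩ => (hsurj n hn).imp fun a ha => Subtype.ext ha⟩
  refine ⟨_, τ.symm, fun i j hij => hr.lt_iff_lt.1 ?_⟩
  have h1 : ∀ i, r (τ.symm i) = i.1 := fun i => congrArg Subtype.val (τ.apply_symm_apply i)
  rwa [h1, h1]

/-- Bars can be enumerated in lexicographic order if finitely many start in each degree and none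
starts in a low degree. -/
theorem exists_lex_enumeration {ι : Type*} (s : ι → ℤ) (m : ι → ℕ∞) (p₀ : ℤ)
    (hp₀ : ∀ k, p₀ < s k) (hfin : ∀ t, {k | s k = t}.Finite) :
    ∃ (K : ℕ∞) (σ : {i : ℕ // (i : ℕ∞) < K} ≃ ι),
      (∀ i j, i ≤ j → s (σ i) ≤ s (σ j)) ∧
      ∀ i j, i ≤ j → s (σ i) = s (σ j) → m (σ i) ≤ m (σ j) := by
  classical
  -- An arbitrary linear order breaks ties between bars with the same start and length.
  obtain ⟨γ, _, c, hc⟩ : ∃ (γ : Type _) (_ : LinearOrder γ) (c : ι → γ), Function.Injective c :=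
    ⟨ι, linearOrderOfSTO WellOrderingRel, id, Function.injective_id⟩
  let key : ι → Lex (ℤ × Lex (ℕ∞ × γ)) := fun k => toLex (s k, toLex (m k, c k))
  have hkey : Function.Injective key := fun k l h => by
    have h1 := congrArg (fun a => (ofLex (ofLex a).2).2) h
    exact hc h1
  let order : LinearOrder ι := LinearOrder.lift' key hkey
  have hlt : ∀ k l : ι, order.lt k l → key k < key l := fun k l h => h
  have hle : ∀ k l : ι, order.le k l → key k ≤ key l := fun k l h => h
  have hs : ∀ k l : ι, key k ≤ key l → s k ≤ s l := fun k l h => by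
    rcases Prod.Lex.toLex_le_toLex.1 h with h | h
    exacts [h.le, h.1.le]
  have hm : ∀ k l : ι, key k ≤ key l → s k = s l → m k ≤ m l := fun k l h hkl => by
    rcases Prod.Lex.toLex_le_toLex.1 h with h | h
    · exact absurd hkl h.ne
    · rcases Prod.Lex.toLex_le_toLex.1 h.2 with h | h
      exacts [h.le, h.1.le]
  have hIio : ∀ a : ι, (@Set.Iio ι order.toPreorder a).Finite := fun a => by
    refine ((Set.finite_Ioc p₀ (s a)).biUnion fun t _ => hfin t).subset fun k hk => ?_
    exact Set.mem_biUnion (Set.mem_Ioc.2 ⟨hp₀ k, hs k a (hlt k a hk).le⟩) rfl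
  obtain ⟨K, σ, hσ⟩ := @exists_strictMono_equiv ι order hIio
  have hσ' : ∀ i j, i ≤ j → key (σ i) ≤ key (σ j) := fun i j hij =>
    hle _ _ ((@StrictMono.monotone _ _ _ order.toPreorder _ hσ) hij)
  exact ⟨K, σ, fun i j hij => hs _ _ (hσ' i j hij), fun i j hij => hm _ _ (hσ' i j hij)⟩

/-! ### Homology classes represented by cycles -/

section HomologyClasses

variable {F : Type u} [Field F] (K L : ChainComplex (ModuleCat.{v} F) ℤ) (n : ℤ)

/-- The space of cycles of degree `n`. -/
noncomputable abbrev cycleSpace : Submodule F (K.X n) :=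
  LinearMap.ker (K.d n ((ComplexShape.down ℤ).next n)).hom

/-- The homology class of a cycle. -/
noncomputable def homologyClass : cycleSpace K n →ₗ[F] K.homology n :=
  (K.homologyπ n).hom ∘ₗ (K.sc n).moduleCatCyclesIso.inv.hom

theorem homologyClass_surjective : Function.Surjective (homologyClass K n) := by
  have h1 : Function.Surjective (K.homologyπ n).hom :=
    (ModuleCat.epi_iff_surjective _).1 inferInstance
  have h2 : Function.Surjective (K.sc n).moduleCatCyclesIso.inv.hom :=
    (ModuleCat.epi_iff_surjective _).1 inferInstance
  exact h1.comp h2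

theorem homologyClass_eq_zero_iff (z : cycleSpace K n) :
    homologyClass K n z = 0 ↔
      ∃ w, (K.d ((ComplexShape.down ℤ).prev n) n).hom w = z.1 := by
  have h : homologyClass K n z =
      (K.sc n).moduleCatHomologyIso.inv.hom ((K.sc n).moduleCatLeftHomologyData.π.hom z) :=
    LinearMap.congr_fun (congrArg ModuleCat.Hom.hom (K.sc n).moduleCatCyclesIso_inv_π) z
  have hinj : Function.Injective (K.sc n).moduleCatHomologyIso.inv.hom :=
    (ModuleCat.mono_iff_injective _).1 inferInstance
  rw [h]
  refine (map_eq_zero_iff _ hinj).trans ?_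
  refine (Submodule.Quotient.mk_eq_zero _).trans ?_
  constructor
  · rintro ⟨w, hw⟩
    exact ⟨w, congrArg Subtype.val hw⟩
  · rintro ⟨w, hw⟩
    exact ⟨w, Subtype.ext hw⟩

variable {K L}

theorem map_mem_cycleSpace (f : K ⟶ L) (z : cycleSpace K n) :
    (f.f n).hom z.1 ∈ cycleSpace L n := by
  have h := LinearMap.congr_fun (congrArg ModuleCat.Hom.hom
    (f.comm n ((ComplexShape.down ℤ).next n))) z.1
  have h2 : (K.d n ((ComplexShape.down ℤ).next n)).hom z.1 = 0 := z.2
  refine LinearMap.mem_ker.2 (h.trans ?_)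
  simp [h2]

theorem homologyMap_homologyClass (f : K ⟶ L) (z : cycleSpace K n) :
    (HomologicalComplex.homologyMap f n).hom (homologyClass K n z) =
      homologyClass L n ⟨(f.f n).hom z.1, map_mem_cycleSpace n f z⟩ := by
  have h1 := LinearMap.congr_fun (congrArg ModuleCat.Hom.hom
    (HomologicalComplex.homologyπ_naturality f n)) ((K.sc n).moduleCatCyclesIso.inv.hom z)
  refine h1.trans (congrArg (L.homologyπ n).hom ?_)
  -- Equality of cycles can be checked on the underlying chains.
  have hinj : Function.Injective (L.iCycles n).hom :=
    (ModuleCat.mono_iff_injective _).1 inferInstance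
  apply hinj
  have h2 := LinearMap.congr_fun (congrArg ModuleCat.Hom.hom
    (HomologicalComplex.cyclesMap_i f n)) ((K.sc n).moduleCatCyclesIso.inv.hom z)
  have h3 := LinearMap.congr_fun (congrArg ModuleCat.Hom.hom
    ((K.sc n).moduleCatCyclesIso_inv_iCycles)) z
  have h4 := LinearMap.congr_fun (congrArg ModuleCat.Hom.hom
    ((L.sc n).moduleCatCyclesIso_inv_iCycles)) ⟨(f.f n).hom z.1, map_mem_cycleSpace n f z⟩
  refine h2.trans (Eq.trans ?_ h4.symm)
  exact congrArg (f.f n).hom h3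

end HomologyClasses

/-! ### Decompositions of persistent homology and the homology of the union -/

namespace FilteredComplex

variable {F : Type u} [Field F] (X : FilteredComplex.{u, v} F)

theorem isTransition_PHmap (n : ℤ) : (X.PH n).IsTransition (X.PHmap n) where
  refl p h a := by rw [PHmap_self]; rfl
  trans p q r h h' a := by
    have h1 : X.incl p q h ≫ X.incl q r h' = X.incl p r (h.trans h') := by ext n c; rfl
    have h2 := HomologicalComplex.homologyMap_comp (X.incl p q h) (X.incl q r h') n
    rw [h1] at h2
    exact (LinearMap.congr_fun (congrArg ModuleCat.Hom.hom h2) a).symm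
  step p h a := rfl

variable {X}

theorem LocallyFinite.finiteDimensional_PHcomp (hfin : X.LocallyFinite) (n p : ℤ) :
    FiniteDimensional F (X.PHcomp n p) := by
  have : FiniteDimensional F ((X.level p).X n) := hfin p n
  exact Module.Finite.of_surjective _ (homologyClass_surjective (X.level p) n)

theorem BoundedBelow.exists_PHcomp_eq_zero (hbdd : X.BoundedBelow) (n : ℤ) :
    ∃ p₀, ∀ p ≤ p₀, ∀ a : X.PHcomp n p, a = 0 := by
  obtain ⟨p₀, hp₀⟩ := hbdd n
  refine ⟨p₀, fun p hp a => ?_⟩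
  obtain ⟨⟨⟨c, hc⟩, hz⟩, rfl⟩ := homologyClass_surjective (X.level p) n a
  have h1 := X.filt_mono p p₀ hp n hc
  rw [hp₀] at h1
  have h2 : (⟨⟨c, hc⟩, hz⟩ : cycleSpace (X.level p) n) = 0 := Subtype.ext (Subtype.ext h1)
  exact (congrArg _ h2).trans (map_zero _)

/-- The bars of `exists_barBasis` can be enumerated because each has a nonzero generator: this keeps
the starts above the vanishing range and allows only finitely many per degree. Comparison with the
bar basis of the sum of cyclic modules gives the isomorphism. -/
theorem BoundedBelow.nonempty_decomposition (hbdd : X.BoundedBelow) (hfin : X.LocallyFinite) :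
    Nonempty X.Decomposition := by
  have key : ∀ n, ∃ (K : ℕ∞) (s : {i : ℕ // (i : ℕ∞) < K} → ℤ)
      (m : {i : ℕ // (i : ℕ∞) < K} → ℕ∞), (∀ i, 1 ≤ m i) ∧ (∀ t, {i | s i = t}.Finite) ∧
      (∀ i j, i ≤ j → s i ≤ s j) ∧ (∀ i j, i ≤ j → s i = s j → m i ≤ m j) ∧
      Nonempty (BarBasis (X.PH n) s m) := by
    intro n
    obtain ⟨p₀, hp₀⟩ := hbdd.exists_PHcomp_eq_zero n
    have hfd : ∀ p, FiniteDimensional F ((X.PH n).comp p) :=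
      fun p => hfin.finiteDimensional_PHcomp n p
    obtain ⟨ι, s, m, hm, ⟨B⟩⟩ := exists_barBasis (X.isTransition_PHmap n) p₀ hp₀
    have hmem : ∀ k, k ∈ bars s m (s k) (s k) := fun k =>
      ⟨le_rfl, by simpa using Order.one_le_iff_pos.1 (hm k)⟩
    have hs : ∀ k, p₀ < s k := fun k => by
      by_contra! h
      exact (B.linearIndependent (s k)).ne_zero ⟨k, hmem k⟩ (hp₀ _ h _)
    have hfibre : ∀ t, {k | s k = t}.Finite := fun t => by
      refine (B.finite_bars t t le_rfl).subset ?_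
      rintro k rfl
      exact hmem k
    obtain ⟨K, σ, h1, h2⟩ := exists_lex_enumeration s m p₀ hs hfibre
    exact ⟨K, s ∘ σ, m ∘ σ, fun i => hm _, fun t => (hfibre t).preimage σ.injective.injOn, h1, h2,
      ⟨B.reindex σ⟩⟩
  choose K s m h1 h2 h3 h4 B using key
  exact ⟨⟨K, s, m, h1, h2, h3, h4, fun n => (B n).some.iso (cyclicBarBasis F (s n) (m n))⟩⟩

/-- The bar basis of the persistent homology that belongs to a decomposition. -/
noncomputable def Decomposition.barBasis (D : X.Decomposition) (n : ℤ) :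
    BarBasis (X.PH n) (D.s n) (D.m n) :=
  (cyclicBarBasis F (D.s n) (D.m n)).ofIso (D.iso n)

variable (X) in
/-- The inclusion of `𝓕^p C` into the union of the filtration. -/
def toUnion (p : ℤ) : X.level p ⟶ X.union where
  f n := ModuleCat.ofHom (Submodule.inclusion (le_iSup (fun p => X.filt p n) p))
  comm' _ _ _ := rfl

variable (X) in
/-- The map from `H_n(𝓕^p C)` to the homology of the union. -/
noncomputable def toUnionMap (n p : ℤ) : X.PHcomp n p →ₗ[F] X.union.homology n :=
  (HomologicalComplex.homologyMap (X.toUnion p) n).hom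

theorem toUnionMap_PHmap (n p q : ℤ) (h : p ≤ q) (a : X.PHcomp n p) :
    X.toUnionMap n q (X.PHmap n p q h a) = X.toUnionMap n p a := by
  have h1 : X.incl p q h ≫ X.toUnion q = X.toUnion p := by ext n c; rfl
  have h2 := HomologicalComplex.homologyMap_comp (X.incl p q h) (X.toUnion q) n
  rw [h1] at h2
  exact (LinearMap.congr_fun (congrArg ModuleCat.Hom.hom h2) a).symm

theorem mem_iSup_filt (n : ℤ) (c : X.C.X n) : c ∈ (⨆ p, X.filt p n) ↔ ∃ p, c ∈ X.filt p n :=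
  Submodule.mem_iSup_of_directed _
    (directed_of_isDirected_le fun p q h => X.filt_mono p q h n)

/-- A cycle of the union is one chain, so it already lies in some `𝓕^p C`. -/
theorem exists_toUnionMap_eq (n : ℤ) (a : X.union.homology n) :
    ∃ p b, X.toUnionMap n p b = a := by
  obtain ⟨⟨⟨c, hc⟩, hz⟩, rfl⟩ := homologyClass_surjective X.union n a
  obtain ⟨p, hp⟩ := (mem_iSup_filt n c).1 hc
  have hz' : (X.C.d n ((ComplexShape.down ℤ).next n)).hom c = 0 := congrArg Subtype.val hz
  refine ⟨p, homologyClass (X.level p) n ⟨⟨c, hp⟩, Subtype.ext hz'⟩, ?_⟩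
  exact homologyMap_homologyClass n (X.toUnion p) _

/-- A bounding chain in the union lies in some `𝓕^q C`, so the class dies at a finite stage. -/
theorem exists_PHmap_eq_zero (n p : ℤ) (a : X.PHcomp n p) (ha : X.toUnionMap n p a = 0) :
    ∃ q, ∃ h : p ≤ q, X.PHmap n p q h a = 0 := by
  obtain ⟨⟨⟨c, hc⟩, hz⟩, rfl⟩ := homologyClass_surjective (X.level p) n a
  have h1 := (homologyMap_homologyClass n (X.toUnion p) ⟨⟨c, hc⟩, hz⟩).symm.trans ha
  obtain ⟨⟨w, hw⟩, hdw⟩ := (homologyClass_eq_zero_iff _ n _).1 h1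
  have hdw' : (X.C.d ((ComplexShape.down ℤ).prev n) n).hom w = c := congrArg Subtype.val hdw
  obtain ⟨q, hq⟩ := (mem_iSup_filt _ w).1 hw
  refine ⟨max p q, le_max_left _ _, ?_⟩
  refine (homologyMap_homologyClass n (X.incl p (max p q) (le_max_left _ _)) _).trans ?_
  exact (homologyClass_eq_zero_iff _ n _).2
    ⟨⟨w, X.filt_mono q _ (le_max_right _ _) _ hq⟩, Subtype.ext hdw'⟩

end FilteredComplex

/-! ### Dimension count in an exact couple -/

namespace ExactCouple

variable {F : Type u} [Field F] {k : ℕ} (X : ExactCouple.{u, v} F k)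
  [∀ n p, FiniteDimensional F (X.A n p)] (n q : ℤ)

theorem finiteDimensional_E : FiniteDimensional F (X.E n q) := by
  have h1 := (X.exact_gh n (n - 1) (q + k) q (q - 1) (by omega) rfl (by omega)).linearMap_ker_eq
  have hn : n - 1 + 1 = n := by omega
  have hq : q - 1 + 1 = q := by omega
  have h2 : Module.Finite F (LinearMap.ker (X.h n (n - 1) q (q - 1) hn hq)) := by
    rw [h1]
    infer_instance
  have := Module.Finite.equiv (X.h n (n - 1) q (q - 1) hn hq).quotKerEquivRange.symm
  exact Module.Finite.of_submodule_quotient (LinearMap.ker (X.h n (n - 1) q (q - 1) hn hq))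

/-- Rank-nullity for `g`, `h` and `f`, with each kernel replaced by the preceding image: `dim E` is
`dim coker f` plus `dim ker f`. The additive form avoids truncated subtraction. -/
theorem finrank_E_add :
    Module.finrank F (X.E n q) +
        Module.finrank F (LinearMap.range (X.f n (q + k - 1) (q + k) (by omega))) +
        Module.finrank F (LinearMap.range (X.f (n - 1) (q - 1) q (by omega))) =
      Module.finrank F (X.A n (q + k)) + Module.finrank F (X.A (n - 1) (q - 1)) := by
  have := X.finiteDimensional_E n q
  have h1 := (X.exact_fg n (q + k - 1) (q + k) q (by omega) rfl).linearMap_ker_eq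
  have h2 := (X.exact_gh n (n - 1) (q + k) q (q - 1) (by omega) rfl (by omega)).linearMap_ker_eq
  have h3 := (X.exact_hf n (n - 1) q (q - 1) q (by omega) (by omega) (by omega)).linearMap_ker_eq
  have e1 := (X.g n (q + k) q rfl).finrank_range_add_finrank_ker
  have e2 := (X.h n (n - 1) q (q - 1) (by omega) (by omega)).finrank_range_add_finrank_ker
  have e3 := (X.f (n - 1) (q - 1) q (by omega)).finrank_range_add_finrank_ker
  rw [h1] at e1
  rw [h2] at e2
  rw [h3] at e3
  omega

end ExactCouple

/-! ### Derived couples and persistent Betti numbers -/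

namespace FilteredComplex

variable {F : Type u} [Field F] {X : FilteredComplex.{u, v} F}

theorem PHmap_PHmap (n p q r : ℤ) (h : p ≤ q) (h' : q ≤ r) (a : X.PHcomp n p) :
    X.PHmap n q r h' (X.PHmap n p q h a) = X.PHmap n p r (h.trans h') a :=
  (X.isTransition_PHmap n).trans p q r h h' a

variable (X) in
/-- The `A`-term of the `k`-th derived couple is `x ^ k H(PC)`. -/
theorem exists_couple_A_embedding (k : ℕ) (n : ℤ) :
    ∃ ι : ∀ p, (X.couple k).A n p →ₗ[F] X.PHcomp n p,
      (∀ p, Function.Injective (ι p)) ∧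
      (∀ (p₀ p : ℤ) (h : p₀ + k = p), LinearMap.range (ι p) =
        LinearMap.range (X.PHmap n p₀ p (by omega))) ∧
      ∀ p q (h : p + 1 = q) a,
        ι q ((X.couple k).f n p q h a) = X.PHmap n p q (by omega) (ι p a) := by
  induction k with
  | zero =>
    refine ⟨fun p => LinearMap.id, fun p => Function.injective_id, fun p₀ p h => ?_,
      fun p q h a => rfl⟩
    obtain rfl : p₀ = p := by simpa using h
    rw [PHmap_self]
    rfl
  | succ k ih =>
    obtain ⟨ι, hinj, hrange, hf⟩ := ih
    refine ⟨fun p => ι p ∘ₗ ((X.couple k).derivedA n p).subtype,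
      fun p => (hinj p).comp Subtype.val_injective, fun p₀ p h => ?_, fun p q h a => hf p q h a.1⟩
    have h' : p₀ + k = p - 1 := by push_cast at h; omega
    ext b
    constructor
    · rintro ⟨⟨_, a, rfl⟩, rfl⟩
      have h1 : ι (p - 1) a ∈ LinearMap.range (ι (p - 1)) := ⟨a, rfl⟩
      rw [hrange p₀ (p - 1) h'] at h1
      obtain ⟨c, hc⟩ := h1
      refine ⟨c, ?_⟩
      refine Eq.trans ?_ (hf (p - 1) p (by omega) a).symm
      rw [← hc, PHmap_PHmap]
    · rintro ⟨c, rfl⟩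
      have h1 : X.PHmap n p₀ (p - 1) (by omega) c ∈ LinearMap.range (ι (p - 1)) := by
        rw [hrange p₀ (p - 1) h']
        exact ⟨c, rfl⟩
      obtain ⟨a, ha⟩ := h1
      refine ⟨⟨(X.couple k).f n (p - 1) p (by omega) a, a, rfl⟩, ?_⟩
      refine (hf (p - 1) p (by omega) a).trans ?_
      rw [ha, PHmap_PHmap]

theorem betti_of_le (n i j : ℤ) (h : i ≤ j) :
    X.betti n i j = Module.finrank F (LinearMap.range (X.PHmap n i j h)) :=
  dif_pos h

section

variable (k : ℕ) (n : ℤ)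

theorem finrank_couple_A (p₀ p : ℤ) (h : p₀ + k = p) :
    Module.finrank F ((X.couple k).A n p) = X.betti n p₀ p := by
  obtain ⟨ι, hinj, hrange, -⟩ := X.exists_couple_A_embedding k n
  rw [betti_of_le n p₀ p (by omega), ← hrange p₀ p h, LinearMap.finrank_range_of_inj (hinj p)]

theorem finrank_range_couple_f (p₀ p q : ℤ) (h : p₀ + k = p) (hq : p + 1 = q) :
    Module.finrank F (LinearMap.range ((X.couple k).f n p q hq)) = X.betti n p₀ q := by
  obtain ⟨ι, hinj, hrange, hf⟩ := X.exists_couple_A_embedding k n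
  have h1 : (LinearMap.range ((X.couple k).f n p q hq)).map (ι q) =
      LinearMap.range (X.PHmap n p₀ q (by omega)) := by
    have h2 : ι q ∘ₗ (X.couple k).f n p q hq = X.PHmap n p q (by omega) ∘ₗ ι p :=
      LinearMap.ext fun a => hf p q hq a
    have h3 : X.PHmap n p q (by omega) ∘ₗ X.PHmap n p₀ p (by omega) = X.PHmap n p₀ q (by omega) :=
      LinearMap.ext fun a => PHmap_PHmap n p₀ p q _ _ a
    rw [← LinearMap.range_comp, h2, LinearMap.range_comp, hrange p₀ p h, ← LinearMap.range_comp, h3]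
  rw [betti_of_le n p₀ q (by omega), ← h1]
  exact (LinearEquiv.finrank_eq (Submodule.equivMapOfInjective _ (hinj q) _))

theorem LocallyFinite.finiteDimensional_couple_A (hfin : X.LocallyFinite) (n p : ℤ) :
    FiniteDimensional F ((X.couple k).A n p) := by
  obtain ⟨ι, hinj, -, -⟩ := X.exists_couple_A_embedding k n
  have := hfin.finiteDimensional_PHcomp n p
  exact FiniteDimensional.of_injective (ι p) (hinj p)

theorem LocallyFinite.finiteDimensional_page (hfin : X.LocallyFinite) (r : ℕ) (n q : ℤ) :
    FiniteDimensional F (X.page r n q) := by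
  have := hfin.finiteDimensional_couple_A (r - 1)
  exact (X.couple (r - 1)).finiteDimensional_E n q

/-- The two `A`-terms adjacent to `E` are the images under `x ^ k` of `H_n(𝓕^q C)` and
`H_(n-1)(𝓕^(q-1-k) C)`, which explains the indices. -/
theorem LocallyFinite.finrank_couple_E_add (hfin : X.LocallyFinite) (n q : ℤ) :
    Module.finrank F ((X.couple k).E n q) + X.betti n (q - 1) (q + k) +
        X.betti (n - 1) (q - 1 - k) q =
      X.betti n q (q + k) + X.betti (n - 1) (q - 1 - k) (q - 1) := by
  have := hfin.finiteDimensional_couple_A k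
  have h := (X.couple k).finrank_E_add n q
  rwa [finrank_couple_A k n q (q + k) rfl, finrank_couple_A k (n - 1) (q - 1 - k) (q - 1) (by omega),
    finrank_range_couple_f k n (q - 1) _ _ (by omega),
    finrank_range_couple_f k (n - 1) (q - 1 - k) _ _ (by omega)] at h

end

namespace Decomposition

variable (D : X.Decomposition)

theorem betti_eq (n i j : ℤ) (h : i ≤ j) :
    X.betti n i j = (bars (D.s n) (D.m n) i j).ncard := by
  rw [betti_of_le n i j h]
  exact (D.barBasis n).finrank_range (X.isTransition_PHmap n) i j h

theorem finite_bars (hfin : X.LocallyFinite) (n i j : ℤ) (h : i ≤ j) :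
    (bars (D.s n) (D.m n) i j).Finite := by
  have : FiniteDimensional F ((X.PH n).comp j) := hfin.finiteDimensional_PHcomp n j
  exact (D.barBasis n).finite_bars i j h

end Decomposition

end FilteredComplex

/-! ### Counting bars by start and end -/

/-- Passing from degree `j` to degree `j + 1` kills the bars with end `j + 1`. -/
theorem ncard_bars_sub_one {ι : Type*} (s : ι → ℤ) (m : ι → ℕ∞) (i j : ℤ) (hij : i < j)
    (hfin : (bars s m i (j - 1)).Finite) :
    {k | s k ≤ i ∧ m k = ((j - s k).toNat : ℕ∞)}.Finite ∧
      (bars s m i (j - 1)).ncard =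
        (bars s m i j).ncard + {k | s k ≤ i ∧ m k = ((j - s k).toNat : ℕ∞)}.ncard := by
  have hU : bars s m i (j - 1) = bars s m i j ∪ {k | s k ≤ i ∧ m k = ((j - s k).toNat : ℕ∞)} := by
    ext k
    have h1 (hk : s k ≤ i) : (j - s k).toNat = (j - 1 - s k).toNat + 1 := by omega
    have h2 (hk : s k ≤ i) : ((j - 1 - s k).toNat : ℕ∞) < m k ↔
        ((j - s k).toNat : ℕ∞) < m k ∨ m k = ((j - s k).toNat : ℕ∞) := by
      rw [h1 hk]
      induction m k using ENat.recTopCoe with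
      | top => simp
      | coe a =>
        norm_cast
        omega
    constructor
    · rintro ⟨hk, hm⟩
      exact ((h2 hk).1 hm).imp (fun h => ⟨hk, h⟩) fun h => ⟨hk, h⟩
    · rintro (⟨hk, hm⟩ | ⟨hk, hm⟩)
      exacts [⟨hk, (h2 hk).2 (Or.inl hm)⟩, ⟨hk, (h2 hk).2 (Or.inr hm)⟩]
  have hfin' := hU ▸ hfin
  refine ⟨hfin'.subset Set.subset_union_right, ?_⟩
  rw [hU, Set.ncard_union_eq _ (hfin'.subset Set.subset_union_left)
    (hfin'.subset Set.subset_union_right)]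
  exact Set.disjoint_left.2 fun k h h' => h.2.ne' h'.2

theorem ncard_sep_le {ι : Type*} (s : ι → ℤ) (P : ι → Prop) (i : ℤ)
    (hfin : {k | s k ≤ i ∧ P k}.Finite) :
    {k | s k = i ∧ P k}.Finite ∧ {k | s k ≤ i ∧ P k}.ncard =
      {k | s k ≤ i - 1 ∧ P k}.ncard + {k | s k = i ∧ P k}.ncard := by
  have hU : {k | s k ≤ i ∧ P k} = {k | s k ≤ i - 1 ∧ P k} ∪ {k | s k = i ∧ P k} := by
    ext k
    have : s k ≤ i ↔ s k ≤ i - 1 ∨ s k = i := by omega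
    constructor
    · rintro ⟨h, hP⟩
      exact (this.1 h).imp (fun h => ⟨h, hP⟩) fun h => ⟨h, hP⟩
    · rintro (⟨h, hP⟩ | ⟨h, hP⟩)
      exacts [⟨this.2 (Or.inl h), hP⟩, ⟨this.2 (Or.inr h), hP⟩]
  have hfin' := hU ▸ hfin
  refine ⟨hfin'.subset Set.subset_union_right, ?_⟩
  rw [hU, Set.ncard_union_eq _ (hfin'.subset Set.subset_union_left)
    (hfin'.subset Set.subset_union_right)]
  refine Set.disjoint_left.2 fun k h h' => ?_
  have h1 := h.1
  have h2 := h'.1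
  omega

/-! ### Infinite bars, multiplicities and page dimensions -/

namespace FilteredComplex

variable {F : Type u} [Field F] {X : FilteredComplex.{u, v} F}

namespace Decomposition

variable (D : X.Decomposition)

/-- The bars of infinite length. -/
def infiniteBars (n : ℤ) : Set {i : ℕ // (i : ℕ∞) < D.K n} := {k | D.m n k = ⊤}

/-- The bars of finite length at least `r`. -/
def finiteBars (r : ℕ) (n : ℤ) : Set {i : ℕ // (i : ℕ∞) < D.K n} :=
  {k | (r : ℕ∞) ≤ D.m n k ∧ D.m n k ≠ ⊤}

theorem mem_bars_of_eq_top {n i j : ℤ} {k : {i : ℕ // (i : ℕ∞) < D.K n}} (hm : D.m n k = ⊤)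
    (hk : D.s n k ≤ i) : k ∈ bars (D.s n) (D.m n) i j :=
  ⟨hk, hm ▸ ENat.natCast_lt_top _⟩

/-- All but finitely many degrees `j` see only bars of infinite length among those that start in
degree at most `i`. -/
theorem exists_bars_subset (hfin : X.LocallyFinite) (n i : ℤ) :
    ∃ j, i ≤ j ∧ bars (D.s n) (D.m n) i j ⊆ D.infiniteBars n := by
  -- Bars that start by degree `i` and are alive later are alive in degree `i`, so there are
  -- finitely many; `j` bounds the ends of the finite ones.
  obtain ⟨j, hj⟩ := ((D.finite_bars hfin n i i le_rfl).image
    fun k => D.s n k + ((D.m n k).toNat : ℤ)).bddAbove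
  refine ⟨max i j, le_max_left _ _, fun k hk => ?_⟩
  by_contra hm
  have hm' : D.m n k = ((D.m n k).toNat : ℕ∞) := (ENat.natCast_toNat hm).symm
  have h1 : k ∈ bars (D.s n) (D.m n) i i := by
    refine ⟨hk.1, lt_of_le_of_lt ?_ hk.2⟩
    have := le_max_left i j
    exact Nat.cast_le.2 (by omega)
  have h2 : D.s n k + ((D.m n k).toNat : ℤ) ≤ j := hj ⟨k, h1, rfl⟩
  have h3 := hk.2
  rw [hm', Nat.cast_lt] at h3
  have := le_max_right i j
  omega

/-- For fixed `i`, a large `j` removes all finite bars, while infinite bars that start by `i` count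
for every `j`. Any finite set of infinite bars has started by some `i`. -/
theorem totalBetti_eq (hfin : X.LocallyFinite) (n : ℤ) :
    X.totalBetti n = (D.infiniteBars n).encard := by
  have hb : ∀ i j, i ≤ j → (X.betti n i j : ℕ∞) = (bars (D.s n) (D.m n) i j).encard :=
    fun i j h => by rw [D.betti_eq n i j h, (D.finite_bars hfin n i j h).cast_ncard_eq]
  refine le_antisymm (iSup_le fun i => ?_) (le_encard_of_forall_finset fun T hT => ?_)
  · obtain ⟨j, hij, hj⟩ := D.exists_bars_subset hfin n i
    refine (iInf_le _ ⟨j, hij⟩).trans ?_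
    rw [hb i j hij]
    exact Set.encard_le_encard hj
  · obtain ⟨i, hi⟩ := (T.image (D.s n)).exists_le
    refine le_trans (le_iInf fun j => ?_) (le_iSup
      (fun i : ℤ => ⨅ j : {j : ℤ // i ≤ j}, (X.betti n i j : ℕ∞)) i)
    rw [hb i j j.2, ← Set.encard_coe_eq_coe_finsetCard]
    exact Set.encard_le_encard fun k hk =>
      D.mem_bars_of_eq_top (hT hk) (hi _ (Finset.mem_image_of_mem _ hk))

theorem encard_infiniteBars (n : ℤ) :
    ∑' s : ℤ, D.nu n s ⊤ = (D.infiniteBars n).encard :=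
  tsum_encard_fiber (D.infiniteBars n) (fun s => {i | D.s n i = s ∧ D.m n i = ⊤}) (D.s n)
    fun _ _ => and_comm

/-- The element of degree `p` of the `k`-th bar. -/
noncomputable def element (n p : ℤ) (k : {i : ℕ // (i : ℕ∞) < D.K n}) : X.PHcomp n p :=
  (D.barBasis n).e k p

theorem PHmap_element (n p q : ℤ) (k : {i : ℕ // (i : ℕ∞) < D.K n}) (h : D.s n k ≤ p)
    (hpq : p ≤ q) : X.PHmap n p q hpq (D.element n p k) = D.element n q k :=
  (D.barBasis n).map_e (X.isTransition_PHmap n) k p q h hpq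

/-- The image of a generator in the homology of the union of the filtration. -/
noncomputable def unionClass (n : ℤ) (k : {i : ℕ // (i : ℕ∞) < D.K n}) : X.union.homology n :=
  X.toUnionMap n (D.s n k) (D.element n (D.s n k) k)

theorem toUnionMap_element (n p : ℤ) (k : {i : ℕ // (i : ℕ∞) < D.K n}) (h : D.s n k ≤ p) :
    X.toUnionMap n p (D.element n p k) = D.unionClass n k := by
  rw [← D.PHmap_element n (D.s n k) p k le_rfl h]
  exact toUnionMap_PHmap n _ p h _

/-- A relation involves finitely many bars, so it comes from one `H_n(𝓕^p C)` and holds in some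
`H_n(𝓕^q C)`; there the infinite bars still supply basis elements. -/
theorem linearIndependent_unionClass (n : ℤ) :
    LinearIndependent F fun k : D.infiniteBars n => D.unionClass n k := by
  rw [linearIndependent_iff']
  intro T c hsum k hk
  obtain ⟨p, hp⟩ := (T.image fun k : D.infiniteBars n => D.s n k.1).exists_le
  have hp' : ∀ k ∈ T, D.s n k ≤ p := fun k hk => hp _ (Finset.mem_image_of_mem _ hk)
  have h1 : X.toUnionMap n p (∑ k ∈ T, c k • D.element n p k) = 0 := by
    rw [map_sum, ← hsum]
    refine Finset.sum_congr rfl fun k hk => ?_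
    rw [map_smul, D.toUnionMap_element n p k (hp' k hk)]
  obtain ⟨q, hpq, hq⟩ := exists_PHmap_eq_zero n p _ h1
  have h2 : ∑ k ∈ T, c k • D.element n q k = 0 := by
    rw [← hq, map_sum]
    refine Finset.sum_congr rfl fun k hk => ?_
    rw [map_smul]
    rw [D.PHmap_element n p q k (hp' k hk) hpq]
  have h3 : LinearIndependent F fun k : T => D.element n q k.1.1 :=
    ((D.barBasis n).linearIndependent q).comp
      (fun k : T => (⟨k.1.1, D.mem_bars_of_eq_top k.1.2 ((hp' k.1 k.2).trans hpq)⟩ :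
        bars (D.s n) (D.m n) q q))
      fun k l h => Subtype.ext (Subtype.ext (congrArg (fun a => a.1) h))
  refine linearIndependent_iff'.1 h3 Finset.univ (fun k => c k) ?_ ⟨k, hk⟩ (Finset.mem_univ _)
  rw [← h2]
  exact Finset.sum_coe_sort T fun k => c k • D.element n q k.1

theorem span_unionClass (n : ℤ) :
    ⊤ ≤ Submodule.span F (Set.range fun k : D.infiniteBars n => D.unionClass n k) := by
  rintro a -
  obtain ⟨p, b, rfl⟩ := exists_toUnionMap_eq n a
  have hb : b ∈ Submodule.span F _ := (D.barBasis n).span p trivial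
  suffices h : Submodule.span F (Set.range fun k : bars (D.s n) (D.m n) p p =>
      D.element n p k) ≤
      (Submodule.span F (Set.range fun k : D.infiniteBars n => D.unionClass n k)).comap
        (X.toUnionMap n p) from h hb
  refine Submodule.span_le.2 ?_
  rintro _ ⟨k, rfl⟩
  have hk : D.s n k ≤ p := k.2.1
  rw [SetLike.mem_coe, Submodule.mem_comap, D.toUnionMap_element n p k hk]
  by_cases hm : D.m n k = ⊤
  · exact Submodule.subset_span ⟨⟨k, hm⟩, rfl⟩
  · have hm' := (ENat.natCast_toNat hm).symm
    -- The class of a finite bar can be computed in the degree where the bar ends, and there its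
    -- element is zero.
    have h0 : D.unionClass n k = 0 := by
      rw [← D.toUnionMap_element n (D.s n k + (D.m n k).toNat) k (by omega)]
      refine (congrArg _ ((D.barBasis n).e_eq_zero k _ (by omega) ?_)).trans (map_zero _)
      rw [hm']
      exact Nat.cast_le.2 (by simp)
    rw [h0]
    exact Submodule.zero_mem _

theorem rank_union_homology (n : ℤ) :
    Cardinal.toENat (Module.rank F (X.union.homology n)) = (D.infiniteBars n).encard := by
  have h := (Module.Basis.mk (D.linearIndependent_unionClass n)
    (D.span_unionClass n)).mk_eq_rank
  have h2 := congrArg Cardinal.toENat h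
  simp only [Cardinal.toENat_lift] at h2
  exact h2.symm

/-- The difference in `j` counts the bars that end in degree `t` and start by a given degree; the
difference in `i` then leaves those that start exactly in degree `s`. -/
theorem mu_eq (hfin : X.LocallyFinite) (n s t : ℤ) (hst : s < t) :
    0 ≤ X.mu n s t ∧ D.nu n s ((t - s).toNat : ℕ∞) = ((X.mu n s t).toNat : ℕ∞) := by
  obtain ⟨f1, h1⟩ := ncard_bars_sub_one (D.s n) (D.m n) s t hst
    (D.finite_bars hfin n s (t - 1) (by omega))
  obtain ⟨f2, h2⟩ := ncard_bars_sub_one (D.s n) (D.m n) (s - 1) t (by omega)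
    (D.finite_bars hfin n (s - 1) (t - 1) (by omega))
  obtain ⟨f3, h3⟩ := ncard_sep_le (D.s n) (fun k => D.m n k = ((t - D.s n k).toNat : ℕ∞)) s f1
  have hnu : {k | D.s n k = s ∧ D.m n k = ((t - s).toNat : ℕ∞)} =
      {k | D.s n k = s ∧ D.m n k = ((t - D.s n k).toNat : ℕ∞)} := by
    ext k
    exact and_congr_right fun h => by rw [h]
  have hmu : X.mu n s t =
      ({k | D.s n k = s ∧ D.m n k = ((t - D.s n k).toNat : ℕ∞)}.ncard : ℤ) := by
    rw [mu, D.betti_eq n s (t - 1) (by omega), D.betti_eq n s t (by omega),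
      D.betti_eq n (s - 1) (t - 1) (by omega), D.betti_eq n (s - 1) t (by omega)]
    omega
  rw [hmu, nu, hnu]
  exact ⟨by omega, by rw [Int.toNat_natCast, f3.cast_ncard_eq]⟩

/-- The cokernel of `f` sees bars of `H_n` at their start `q`, the kernel of `f` sees bars of
`H_(n-1)` at their end `q`; in both cases `x ^ k` leaves only lengths at least `k + 1`. -/
theorem finrank_couple_E (hfin : X.LocallyFinite) (k : ℕ) (n q : ℤ) :
    (Module.finrank F ((X.couple k).E n q) : ℕ∞) =
      {i | D.s n i = q ∧ ((k + 1 : ℕ) : ℕ∞) ≤ D.m n i}.encard +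
        {i | D.s (n - 1) i ≤ q - 1 - k ∧
          D.m (n - 1) i = ((q - D.s (n - 1) i).toNat : ℕ∞)}.encard := by
  obtain ⟨f1, h1⟩ := ncard_bars_sub_one (D.s (n - 1)) (D.m (n - 1)) (q - 1 - k) q (by omega)
    (D.finite_bars hfin (n - 1) (q - 1 - k) (q - 1) (by omega))
  obtain ⟨f2, h2⟩ := ncard_sep_le (D.s n) (fun i => ((q + k - D.s n i).toNat : ℕ∞) < D.m n i) q
    (D.finite_bars hfin n q (q + k) (by omega))
  have hset : {i | D.s n i = q ∧ ((k + 1 : ℕ) : ℕ∞) ≤ D.m n i} =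
      {i | D.s n i = q ∧ ((q + k - D.s n i).toNat : ℕ∞) < D.m n i} := by
    ext i
    refine and_congr_right fun h => ?_
    rw [h, show (q + k - q).toNat = k by omega, Nat.cast_add, Nat.cast_one,
      ENat.add_one_le_iff (ENat.natCast_ne_top k)]
  have h := hfin.finrank_couple_E_add k n q
  rw [D.betti_eq n (q - 1) (q + k) (by omega), D.betti_eq (n - 1) (q - 1 - k) q (by omega),
    D.betti_eq n q (q + k) (by omega), D.betti_eq (n - 1) (q - 1 - k) (q - 1) (by omega)] at h
  rw [hset, ← f1.cast_ncard_eq, ← f2.cast_ncard_eq, ← Nat.cast_add, Nat.cast_inj]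
  simp only [bars] at *
  omega

theorem pageDim_eq (hfin : X.LocallyFinite) (r : ℕ) (hr : 0 < r) (n : ℤ) :
    X.pageDim r n = (D.infiniteBars n).encard +
      ((D.finiteBars r n).encard + (D.finiteBars r (n - 1)).encard) := by
  have := hfin.finiteDimensional_page r n
  rw [pageDim, toENat_rank_directSum]
  have hr' : r - 1 + 1 = r := by omega
  simp only [D.finrank_couple_E hfin]
  rw [ENat.tsum_add, tsum_encard_fiber {i | (r : ℕ∞) ≤ D.m n i} _ (D.s n),
    tsum_encard_fiber (D.finiteBars r (n - 1)) _
      -- This is the end of a finite bar; each one is counted for exactly one `q`.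
      (fun i => D.s (n - 1) i + ((D.m (n - 1) i).toNat : ℤ)), ← add_assoc]
  · congr 1
    rw [← Set.encard_union_eq]
    · congr 1
      ext i
      by_cases hm : D.m n i = ⊤ <;> simp [infiniteBars, finiteBars, hm]
    · exact Set.disjoint_left.2 fun i h h' => h'.2 h
  · intro q i
    constructor
    · rintro ⟨h1, h2⟩
      refine ⟨⟨?_, ?_⟩, ?_⟩
      · rw [h2]
        exact Nat.cast_le.2 (by omega)
      · rw [h2]
        exact ENat.natCast_ne_top _
      · have h3 : (D.m (n - 1) i).toNat = (q - D.s (n - 1) i).toNat := by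
          rw [h2, ENat.toNat_natCast]
        omega
    · rintro ⟨⟨h1, h2⟩, h3⟩
      have hm := (ENat.natCast_toNat h2).symm
      rw [hm, Nat.cast_le] at h1
      have h4 : D.s (n - 1) i + ((D.m (n - 1) i).toNat : ℤ) = q := h3
      refine ⟨by omega, ?_⟩
      exact hm.trans (congrArg _ (by omega))
  · intro q i
    rw [hr']
    exact and_comm

theorem tsum_nu_finite (r : ℕ) (n : ℤ) :
    ∑' (s : ℤ) (m : {m : ℕ // r ≤ m}), D.nu n s m = (D.finiteBars r n).encard := by
  have h : ∀ s, ∑' m : {m : ℕ // r ≤ m}, D.nu n s m =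
      {i | D.s n i = s ∧ i ∈ D.finiteBars r n}.encard := fun s => by
    refine tsum_encard_fiber _ (fun m : {m : ℕ // r ≤ m} => {i | D.s n i = s ∧ D.m n i = m})
      -- The maximum with `r` only makes the map total; on `finiteBars r n` the value is the length
      -- of the bar.
      (fun i => ⟨max r (D.m n i).toNat, le_max_left _ _⟩) fun m i => ?_
    constructor
    · rintro ⟨h1, h2⟩
      have h3 : (D.m n i).toNat = m := by rw [h2, ENat.toNat_natCast]
      refine ⟨⟨h1, ?_, ?_⟩, Subtype.ext ?_⟩
      · rw [h2]
        exact Nat.cast_le.2 m.2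
      · rw [h2]
        exact ENat.natCast_ne_top _
      · exact (congrArg (max r) h3).trans (max_eq_right m.2)
    · rintro ⟨⟨h1, h2, h3⟩, h4⟩
      have hm := (ENat.natCast_toNat h3).symm
      rw [hm, Nat.cast_le] at h2
      refine ⟨h1, ?_⟩
      have h5 : max r (D.m n i).toNat = m := congrArg Subtype.val h4
      rw [hm, ← h5, max_eq_right h2]
  simp only [h]
  exact tsum_encard_fiber _ _ (D.s n) fun s i => and_comm

theorem tsum_nu_sub (r : ℕ) (n : ℤ) :
    ∑' p : {p : ℤ × ℤ // (r : ℤ) ≤ p.2 - p.1}, D.nu n p.1.1 ((p.1.2 - p.1.1).toNat : ℕ∞) =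
      (D.finiteBars r n).encard := by
  refine tsum_encard_fiber _
    (fun p : {p : ℤ × ℤ // (r : ℤ) ≤ p.2 - p.1} =>
      {i | D.s n i = p.1.1 ∧ D.m n i = ((p.1.2 - p.1.1).toNat : ℕ∞)})
    (fun i => ⟨(D.s n i, D.s n i + ((max r (D.m n i).toNat : ℕ) : ℤ)), by simp⟩) fun p i => ?_
  have hp := p.2
  constructor
  · rintro ⟨h1, h2⟩
    have h3 : (D.m n i).toNat = (p.1.2 - p.1.1).toNat := by rw [h2, ENat.toNat_natCast]
    refine ⟨⟨?_, ?_⟩, Subtype.ext (Prod.ext h1 ?_)⟩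
    · rw [h2]
      exact Nat.cast_le.2 (by omega)
    · rw [h2]
      exact ENat.natCast_ne_top _
    · change D.s n i + ((max r (D.m n i).toNat : ℕ) : ℤ) = p.1.2
      omega
  · rintro ⟨⟨h2, h3⟩, h4⟩
    have hm := (ENat.natCast_toNat h3).symm
    rw [hm, Nat.cast_le] at h2
    have h5 : D.s n i = p.1.1 := congrArg (fun p => p.1.1) h4
    have h6 : D.s n i + ((max r (D.m n i).toNat : ℕ) : ℤ) = p.1.2 := congrArg (fun p => p.1.2) h4
    refine ⟨h5, hm.trans (congrArg _ ?_)⟩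
    omega

end Decomposition

end FilteredComplex

end PersistentSS

/-! ### The dimension formulas -/

open PersistentSS in
theorem corollary1p9 {F : Type u} [Field F] (X : FilteredComplex.{u, v} F)
    (hbdd : X.BoundedBelow) (hfin : X.LocallyFinite) :
    -- the sequences that define the multiplicities exist
    Nonempty X.Decomposition ∧
    ∀ D : X.Decomposition,
      -- the dimension formula in terms of the multiplicities
      (∀ (r : ℕ), 0 < r → ∀ n : ℤ, X.pageDim r n =
        ∑' s : ℤ, (D.nu n s ⊤ + ∑' m : {m : ℕ // r ≤ m}, (D.nu n s m + D.nu (n - 1) s m))) ∧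
      -- the dimension formula in terms of persistent Betti numbers and multiplicities
      (∀ (r : ℕ), 0 < r → ∀ n : ℤ, X.pageDim r n =
        X.totalBetti n + ∑' p : {p : ℤ × ℤ // (r : ℤ) ≤ p.2 - p.1},
          ((X.mu n p.1.1 p.1.2).toNat + (X.mu (n - 1) p.1.1 p.1.2).toNat : ℕ∞)) ∧
      -- the translation between the two formulas
      (∀ n s t : ℤ, s < t → 0 ≤ X.mu n s t ∧
        D.nu n s ((t - s).toNat : ℕ∞) = ((X.mu n s t).toNat : ℕ∞)) ∧
      (∀ n : ℤ, X.totalBetti n = ∑' s : ℤ, D.nu n s ⊤) ∧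
      (∀ n : ℤ, X.totalBetti n = Cardinal.toENat (Module.rank F (X.union.homology n))) := by
  refine ⟨hbdd.nonempty_decomposition hfin, fun D => ⟨fun r hr n => ?_, fun r hr n => ?_,
    fun n s t hst => D.mu_eq hfin n s t hst, fun n => ?_, fun n => ?_⟩⟩
  · rw [D.pageDim_eq hfin r hr n, ENat.tsum_add, D.encard_infiniteBars]
    simp only [ENat.tsum_add]
    rw [D.tsum_nu_finite, D.tsum_nu_finite]
  · have h : ∀ (n : ℤ) (p : {p : ℤ × ℤ // (r : ℤ) ≤ p.2 - p.1}),
        ((X.mu n p.1.1 p.1.2).toNat : ℕ∞) = D.nu n p.1.1 ((p.1.2 - p.1.1).toNat : ℕ∞) :=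
      fun n p => ((D.mu_eq hfin n p.1.1 p.1.2 (by have := p.2; omega)).2).symm
    simp only [h]
    rw [ENat.tsum_add, D.tsum_nu_sub, D.tsum_nu_sub, D.totalBetti_eq hfin, D.pageDim_eq hfin r hr n]
  · rw [D.totalBetti_eq hfin, D.encard_infiniteBars]
  · rw [D.totalBetti_eq hfin, D.rank_union_homology]
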